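/- Let $n\ge 1$, let $\lambda$ be a partition of $n$, and let $S_n$ be the symmetric group with simple reflections $s_i=(i\;\,i+1)$, $1\le i\le n-1$. For a Young tableau $T$ of shape $\lambda$ (a bijective filling with $1,\dots,n$) let $\{T\}$ be its tabloid (its class under row equivalence), let $C(T)$ be its column stabilizer, and let $v_T=\sum_{\sigma\in C(T)}\operatorname{sgn}(\sigma)\,\sigma\{T\}$ be its polytabloid, in the real vector space $M^\lambda$ with basis the tabloids of shape $\lambda$. The Specht module $S^\lambda$ is the $S_n$-submodule of $M^\lambda$ spanned by all $v_T$. Order the set $\mathrm{Std}(\lambda)$ of standard Young tableaux by the last letter order: $T<T'$ if the largest entry that does not lie in the same row of $T$ and $T'$ lies in a row of strictly larger index in $T'$ than in $T$. Then the polytabloids $v_T$, $T\in\mathrm{Std}(\lambda)$, form a basis of $S^\lambda$. Let $A_s$ denote the matrix of $1+s$ in this basis for a simple reflection $s$, and let $G$ be the Gram matrix, in this basis, of any $S_n$-invariant positive definite symmetric bilinear form on $S^\lambda$ (for instance the restriction of the form on $M^\lambda$ for which the tabloids are orthonormal). Consider the problem of minimizing $$f(A)=\mathrm{Tr}(A^tGA)$$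 over all real matrices $A$, with rows and columns indexed by the ordered set $\mathrm{Std}(\lambda)$, such that $A$ is upper unitriangular and $A^{-1}A_sA$ has only non-negative entries for every simple reflection $s$. **Theorem.** This problem has exactly one minimizer $A_{\min}$, and $A_{\min}$ is the base-change matrix from the polytabloid basis to Young's seminormal basis. That is, an upper unitriangular matrix $A$ is a minimizer if and only if the vectors $e_T=\sum_{S\in\mathrm{Std}(\lambda)}A_{S,T}\,v_S$, $T\in\mathrm{Std}(\lambda)$, form a basis of $S^\lambda$ on which the simple reflections act by Young's seminormal formulas $$s_i e_T=\begin{cases} e_T, & i,i+1 \text{ in the same row of } T,\\ -e_T, & i,i+1 \text{ in the same column of } T,\\ a_i(T)^{-1}e_T+e_{s_iT}, & s_iT\in\mathrm{Std}(\lambda),\ T<s_iT,\\ a_i(T)^{-1}e_T+\bigl(1-a_i(T)^{-2}\bigr)e_{s_iT}, & s_iT\in\mathrm{Std}(\lambda),\ s_iT<T,\end{cases}$$ where $a_i(T)=(c_{i+1}-r_{i+1})-(c_i-r_i)$ and $r_k$, $c_k$ are the row and column index of the entry $k$ in $T$. -/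

import Mathlib

open Module

namespace SpechtOpt

/-- A Young tableau of shape `μ` with entries in `Fin n`: a bijective filling of the cells.
The entry `k : Fin n` stands for the number `k + 1`; a cell `(r, c)` has row `r` and column `c`. -/
def Tableau (n : ℕ) (μ : YoungDiagram) : Type :=
  {c : ℕ × ℕ // c ∈ μ.cells} ≃ Fin n

variable {n : ℕ} {μ : YoungDiagram}

namespace Tableau

instance : Fintype (Tableau n μ) :=
  inferInstanceAs (Fintype ({c : ℕ × ℕ // c ∈ μ.cells} ≃ Fin n))

instance : DecidableEq (Tableau n μ) :=
  inferInstanceAs (DecidableEq ({c : ℕ × ℕ // c ∈ μ.cells} ≃ Fin n))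

/-- The entry of `T` in the cell `c`. -/
def entry (T : Tableau n μ) (c : {c : ℕ × ℕ // c ∈ μ.cells}) : Fin n :=
  Equiv.toFun T c

/-- The cell of `T` containing the entry `k`. -/
def pos (T : Tableau n μ) (k : Fin n) : {c : ℕ × ℕ // c ∈ μ.cells} :=
  Equiv.invFun T k

/-- The row index of the entry `k`. -/
def row (T : Tableau n μ) (k : Fin n) : ℕ := (T.pos k).1.1

/-- The column index of the entry `k`. -/
def col (T : Tableau n μ) (k : Fin n) : ℕ := (T.pos k).1.2

/-- `σ • T` is obtained by applying `σ` to every entry of `T`. -/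
instance : MulAction (Equiv.Perm (Fin n)) (Tableau n μ) where
  smul σ T := Equiv.trans T σ
  one_smul _ := rfl
  mul_smul _ _ _ := rfl

theorem entry_smul (σ : Equiv.Perm (Fin n)) (T : Tableau n μ)
    (c : {c : ℕ × ℕ // c ∈ μ.cells}) : (σ • T).entry c = σ (T.entry c) := rfl

theorem pos_smul (σ : Equiv.Perm (Fin n)) (T : Tableau n μ) (k : Fin n) :
    (σ • T).pos k = T.pos (σ⁻¹ k) := rfl

theorem row_smul (σ : Equiv.Perm (Fin n)) (T : Tableau n μ) (k : Fin n) :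
    (σ • T).row k = T.row (σ⁻¹ k) := rfl

theorem col_smul (σ : Equiv.Perm (Fin n)) (T : Tableau n μ) (k : Fin n) :
    (σ • T).col k = T.col (σ⁻¹ k) := rfl

/-- The row stabilizer `R(T)`. -/
def rowStabilizer (T : Tableau n μ) : Subgroup (Equiv.Perm (Fin n)) where
  carrier := {σ | ∀ k, T.row (σ k) = T.row k}
  one_mem' := fun _ => rfl
  mul_mem' := fun {σ τ} hσ hτ k => (hσ (τ k)).trans (hτ k)
  inv_mem' := fun {σ} hσ k => by
    have h := hσ (σ⁻¹ k)
    rw [show σ (σ⁻¹ k) = k from Equiv.apply_symm_apply σ k] at h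
    exact h.symm

/-- The column stabilizer `C(T)`. -/
def colStabilizer (T : Tableau n μ) : Subgroup (Equiv.Perm (Fin n)) where
  carrier := {σ | ∀ k, T.col (σ k) = T.col k}
  one_mem' := fun _ => rfl
  mul_mem' := fun {σ τ} hσ hτ k => (hσ (τ k)).trans (hτ k)
  inv_mem' := fun {σ} hσ k => by
    have h := hσ (σ⁻¹ k)
    rw [show σ (σ⁻¹ k) = k from Equiv.apply_symm_apply σ k] at h
    exact h.symm

instance (T : Tableau n μ) : DecidablePred (· ∈ T.colStabilizer) :=
  fun σ => inferInstanceAs (Decidable (∀ k, T.col (σ k) = T.col k))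

/-- `T` is standard: its entries increase strictly along rows and down columns. -/
def IsStandard (T : Tableau n μ) : Prop :=
  (∀ c d : {c : ℕ × ℕ // c ∈ μ.cells},
      c.1.1 = d.1.1 → c.1.2 < d.1.2 → T.entry c < T.entry d) ∧
  (∀ c d : {c : ℕ × ℕ // c ∈ μ.cells},
      c.1.2 = d.1.2 → c.1.1 < d.1.1 → T.entry c < T.entry d)

/-- Two tableaux are row equivalent if every entry lies in the same row of both. -/
instance rowSetoid (n : ℕ) (μ : YoungDiagram) : Setoid (Tableau n μ) := Setoid.ker row

theorem equiv_iff_row (T T' : Tableau n μ) : T ≈ T' ↔ T.row = T'.row := Iff.rfl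

/-- Row equivalence is the relation `T' = σ T` for some `σ ∈ R(T)`. -/
theorem equiv_iff (T T' : Tableau n μ) :
    T ≈ T' ↔ ∃ σ ∈ T.rowStabilizer, T' = σ • T := by
  rw [equiv_iff_row]
  constructor
  · intro h
    refine ⟨Equiv.trans (Equiv.symm T) T', fun k => ?_, ?_⟩
    · rw [h]
      have : T'.row (Equiv.trans (Equiv.symm T) T' k) = T.row k := by
        exact congrArg (fun c => c.1.1) (Equiv.symm_apply_apply T' (T.pos k))
      rw [this, h]
    · exact Equiv.ext fun c => (congrArg (Equiv.toFun T') (Equiv.symm_apply_apply T c)).symm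
  · rintro ⟨σ, hσ, rfl⟩
    funext k
    rw [row_smul]
    have := T.rowStabilizer.inv_mem hσ k
    exact this.symm

end Tableau

/-- Tabloids: row equivalence classes of tableaux. -/
def Tabloid (n : ℕ) (μ : YoungDiagram) : Type := Quotient (Tableau.rowSetoid n μ)

/-- The tabloid `{T}` of a tableau `T`. -/
def tabloid (T : Tableau n μ) : Tabloid n μ := Quotient.mk _ T

noncomputable instance : Fintype (Tabloid n μ) :=
  @Fintype.ofFinite _ (inferInstanceAs (Finite (Quotient (Tableau.rowSetoid n μ))))

/-- `σ {T} = {σ T}`. -/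
instance : MulAction (Equiv.Perm (Fin n)) (Tabloid n μ) where
  smul σ := Quotient.map (σ • ·) fun T T' h => by
    rw [Tableau.equiv_iff_row] at h ⊢
    funext k
    exact congrFun h (σ⁻¹ k)
  one_smul t := Quotient.inductionOn t fun _ => rfl
  mul_smul _ _ t := Quotient.inductionOn t fun _ => rfl

theorem smul_tabloid (σ : Equiv.Perm (Fin n)) (T : Tableau n μ) :
    σ • tabloid T = tabloid (σ • T) := rfl

/-- The real vector space `M^μ` with basis the tabloids of shape `μ`. -/
abbrev PermModule (n : ℕ) (μ : YoungDiagram) : Type := Tabloid n μ →₀ ℝ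

/-- The action of the symmetric group on `M^μ` permuting the tabloids. -/
noncomputable def permRep (n : ℕ) (μ : YoungDiagram) :
    Representation ℝ (Equiv.Perm (Fin n)) (PermModule n μ) where
  toFun σ := Finsupp.lmapDomain ℝ ℝ (σ • ·)
  map_one' := by
    refine Finsupp.lhom_ext fun t r => ?_
    simp
  map_mul' σ τ := by
    refine Finsupp.lhom_ext fun t r => ?_
    simp [mul_smul]

theorem permRep_single (σ : Equiv.Perm (Fin n)) (t : Tabloid n μ) (r : ℝ) :
    permRep n μ σ (Finsupp.single t r) = Finsupp.single (σ • t) r := by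
  simp [permRep]

/-- The polytabloid `v_T = ∑_{σ ∈ C(T)} sgn(σ) σ {T}`. -/
noncomputable def polytabloid (T : Tableau n μ) : PermModule n μ :=
  ∑ σ : Equiv.Perm (Fin n) with σ ∈ T.colStabilizer,
    ((Equiv.Perm.sign σ : ℤ) : ℝ) • permRep n μ σ (Finsupp.single (tabloid T) 1)

theorem permRep_polytabloid (σ : Equiv.Perm (Fin n)) (T : Tableau n μ) :
    permRep n μ σ (polytabloid T) = polytabloid (σ • T) := by
  unfold polytabloid
  rw [map_sum]
  refine Finset.sum_bij' (fun τ _ => σ * τ * σ⁻¹) (fun τ _ => σ⁻¹ * τ * σ) ?_ ?_ ?_ ?_ ?_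
  · intro τ hτ
    rw [Finset.mem_filter] at hτ ⊢
    refine ⟨Finset.mem_univ _, fun k => ?_⟩
    have := hτ.2 (σ⁻¹ k)
    simpa [Tableau.col_smul] using this
  · intro τ hτ
    rw [Finset.mem_filter] at hτ ⊢
    refine ⟨Finset.mem_univ _, fun k => ?_⟩
    have := hτ.2 (σ k)
    simpa [Tableau.col_smul] using this
  · intro τ _
    group
  · intro τ _
    group
  · intro τ _
    have hs : Equiv.Perm.sign (σ * τ * σ⁻¹) = Equiv.Perm.sign τ := by
      rw [map_mul, map_mul, mul_right_comm, ← map_mul, mul_inv_cancel, map_one, one_mul]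
    rw [map_smul, permRep_single, permRep_single, permRep_single, hs, ← smul_tabloid,
      smul_smul, smul_smul]
    congr 3
    group

/-- The Specht module `S^μ`: the span of all polytabloids in `M^μ`. -/
noncomputable def Specht (n : ℕ) (μ : YoungDiagram) : Submodule ℝ (PermModule n μ) :=
  Submodule.span ℝ (Set.range (polytabloid (n := n) (μ := μ)))

theorem specht_invariant (σ : Equiv.Perm (Fin n)) :
    Specht n μ ≤ (Specht n μ).comap (permRep n μ σ) := by
  unfold Specht
  rw [Submodule.span_le]
  rintro _ ⟨T, rfl⟩
  rw [SetLike.mem_coe, Submodule.mem_comap, permRep_polytabloid]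
  exact Submodule.subset_span ⟨_, rfl⟩

/-- The action of the symmetric group on `S^μ`. -/
noncomputable def spechtRep (n : ℕ) (μ : YoungDiagram) :
    Representation ℝ (Equiv.Perm (Fin n)) (Specht n μ) :=
  (permRep n μ).subrepresentation (Specht n μ) specht_invariant

/-- Standard Young tableaux of shape `μ`. -/
def Std (n : ℕ) (μ : YoungDiagram) : Type := {T : Tableau n μ // T.IsStandard}

noncomputable instance : Fintype (Std n μ) :=
  @Fintype.ofFinite _ (inferInstanceAs (Finite {T : Tableau n μ // T.IsStandard}))

instance : DecidableEq (Std n μ) :=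
  inferInstanceAs (DecidableEq {T : Tableau n μ // T.IsStandard})

/-- The last letter order: `T < T'` if the largest entry that does not lie in the same row of
both tableaux lies in a row with strictly larger index in `T'` than in `T`. -/
instance : LT (Std n μ) where
  lt T T' := ∃ k : Fin n, T.1.row k < T'.1.row k ∧ ∀ l, k < l → T.1.row l = T'.1.row l

/-- The simple reflection exchanging the `0`-based entries `i` and `i + 1`. -/
def simpleReflection (i : ℕ) (hi : i + 1 < n) : Equiv.Perm (Fin n) :=
  Equiv.swap ⟨i, Nat.lt_of_succ_lt hi⟩ ⟨i + 1, hi⟩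

/-- The axial distance `(c_{i+1} - r_{i+1}) - (c_i - r_i)` between the entries `i`, `i + 1`. -/
def axialDistance (i : ℕ) (hi : i + 1 < n) (T : Std n μ) : ℤ :=
  ((T.1.col ⟨i + 1, hi⟩ : ℤ) - T.1.row ⟨i + 1, hi⟩) -
    ((T.1.col ⟨i, Nat.lt_of_succ_lt hi⟩ : ℤ) - T.1.row ⟨i, Nat.lt_of_succ_lt hi⟩)

/-- A basis `(e_T)` of `S^μ` is in Young's seminormal form if the simple reflections act on it
by Young's seminormal formulas. -/
structure IsYoungSeminormal (e : Basis (Std n μ) ℝ (Specht n μ)) : Prop where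
  same_row : ∀ (i : ℕ) (hi : i + 1 < n) (T : Std n μ),
    T.1.row ⟨i, Nat.lt_of_succ_lt hi⟩ = T.1.row ⟨i + 1, hi⟩ →
    spechtRep n μ (simpleReflection i hi) (e T) = e T
  same_col : ∀ (i : ℕ) (hi : i + 1 < n) (T : Std n μ),
    T.1.col ⟨i, Nat.lt_of_succ_lt hi⟩ = T.1.col ⟨i + 1, hi⟩ →
    spechtRep n μ (simpleReflection i hi) (e T) = - e T
  up : ∀ (i : ℕ) (hi : i + 1 < n) (T T' : Std n μ),
    T'.1 = simpleReflection i hi • T.1 → T < T' →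
    spechtRep n μ (simpleReflection i hi) (e T) =
      (axialDistance i hi T : ℝ)⁻¹ • e T + e T'
  down : ∀ (i : ℕ) (hi : i + 1 < n) (T T' : Std n μ),
    T'.1 = simpleReflection i hi • T.1 → T' < T →
    spechtRep n μ (simpleReflection i hi) (e T) =
      (axialDistance i hi T : ℝ)⁻¹ • e T + (1 - ((axialDistance i hi T : ℝ)⁻¹) ^ 2) • e T'

/-- An invariant positive definite symmetric bilinear form on `S^μ`. -/
structure IsInvariantInnerProduct (B : LinearMap.BilinForm ℝ (Specht n μ)) : Prop where
  symm : ∀ x y, B x y = B y x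
  posDef : ∀ x, x ≠ 0 → 0 < B x x
  invariant : ∀ (σ : Equiv.Perm (Fin n)) (x y : Specht n μ),
    B (spechtRep n μ σ x) (spechtRep n μ σ y) = B x y

/-- The restriction to `S^μ` of the form on `M^μ` for which the tabloids are orthonormal. -/
noncomputable def tabloidForm (n : ℕ) (μ : YoungDiagram) :
    LinearMap.BilinForm ℝ (Specht n μ) :=
  (∑ t : Tabloid n μ, LinearMap.BilinForm.linMulLin
    (Finsupp.lapply (R := ℝ) t) (Finsupp.lapply (R := ℝ) t)).restrict (Specht n μ)

theorem tabloidForm_apply (x y : Specht n μ) :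
    tabloidForm n μ x y = ∑ t : Tabloid n μ, x.1 t * y.1 t := by
  simp [tabloidForm]

theorem permRep_apply (σ : Equiv.Perm (Fin n)) (x : PermModule n μ) (t : Tabloid n μ) :
    permRep n μ σ x (σ • t) = x t :=
  Finsupp.mapDomain_apply (MulAction.injective σ) x t

/-- The tabloid form is an instance of the forms considered. -/
theorem tabloidForm_isInvariantInnerProduct :
    IsInvariantInnerProduct (tabloidForm n μ) where
  symm x y := by simp only [tabloidForm_apply, mul_comm]
  posDef x hx := by
    rw [tabloidForm_apply]
    have hx' : x.1 ≠ 0 := fun h => hx (Subtype.ext h)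
    obtain ⟨t, ht⟩ := Finsupp.ne_iff.mp hx'
    exact Finset.sum_pos' (fun s _ => mul_self_nonneg _)
      ⟨t, Finset.mem_univ _, mul_self_pos.mpr ht⟩
  invariant σ x y := by
    rw [tabloidForm_apply, tabloidForm_apply]
    refine (Fintype.sum_equiv (MulAction.toPerm σ) _ _ fun t => ?_).symm
    change x.1 t * y.1 t = permRep n μ σ x.1 (σ • t) * permRep n μ σ y.1 (σ • t)
    rw [permRep_apply, permRep_apply]

/-- `A` is upper unitriangular with respect to the last letter order. -/
def IsUpperUnitriangular (A : Matrix (Std n μ) (Std n μ) ℝ) : Prop :=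
  (∀ T, A T T = 1) ∧ ∀ S T, T < S → A S T = 0

/-- The matrix `A_s` of `1 + s` in the basis `b`, for the simple reflection `s = s_i`. -/
noncomputable def onePlusMatrix (b : Basis (Std n μ) ℝ (Specht n μ)) (i : ℕ) (hi : i + 1 < n) :
    Matrix (Std n μ) (Std n μ) ℝ :=
  LinearMap.toMatrix b b (1 + spechtRep n μ (simpleReflection i hi))

/-- The feasible region: upper unitriangular matrices `A` such that all entries of
`A⁻¹ A_s A` are non-negative, for every simple reflection `s`. -/
def feasible (b : Basis (Std n μ) ℝ (Specht n μ)) : Set (Matrix (Std n μ) (Std n μ) ℝ) :=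
  {A | IsUpperUnitriangular A ∧
    ∀ (i : ℕ) (hi : i + 1 < n) (S T : Std n μ), 0 ≤ (A⁻¹ * onePlusMatrix b i hi * A) S T}

/-- The objective `Tr(Aᵗ G A)`, where `G` is the Gram matrix of `B` in the basis `b`. -/
noncomputable def objective (b : Basis (Std n μ) ℝ (Specht n μ))
    (B : LinearMap.BilinForm ℝ (Specht n μ)) (A : Matrix (Std n μ) (Std n μ) ℝ) : ℝ :=
  (A.transpose * (Matrix.of fun S T => B (b S) (b T)) * A).trace

/-- `A` is a minimizer of the objective over the feasible region. -/
def IsMinimizer (b : Basis (Std n μ) ℝ (Specht n μ))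
    (B : LinearMap.BilinForm ℝ (Specht n μ)) (A : Matrix (Std n μ) (Std n μ) ℝ) : Prop :=
  A ∈ feasible b ∧ IsMinOn (objective b B) (feasible b) A

end SpechtOpt

/-! The objective is the sum of the squared lengths of the vectors `e_T` given by the columns of `A`
(`objective_eq_sum`). Over all upper unitriangular matrices such a sum is minimized exactly by
unnormalized Gram–Schmidt orthogonalization of the ordered polytabloid basis. So it suffices to show
that Gram–Schmidt produces the seminormal basis, whatever the invariant form, and that this basis is
feasible.

Both follow from the Jucys–Murphy elements. They are self-adjoint for every invariant form, and
standard tableaux are separated by their contents, so joint eigenvectors attached to different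
standard tableaux are orthogonal. The polytabloid of the column filled tableau is such an
eigenvector (`hasWeight_spechtVector_of_columnFilled`). If `x` has the weight of `T` and `s`
exchanges consecutive entries at axial distance `d`, then `s x - d⁻¹ x` has the weight of `s T`
(`hasWeight_swap`). Climbing by ascending simple reflections gives an eigenvector for every standard
tableau.

Each polytabloid equals its eigenvector plus eigenvectors strictly lower in dominance order
(`IsSeminormalVector.exists_add_eq`). Hence the eigenvector does not depend on the chosen path,
Young's formulas hold, and the base change is unitriangular for the last letter order, which refines
dominance. With orthogonality this is the Gram–Schmidt property
(`IsInvariantInnerProduct.seminormalBasis_polytabloidBasis`). Feasibility is read off from Young's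
formulas, because axial distances of exchangeable entries have absolute value at least two. -/

open Module

namespace SpechtOpt

variable {n : ℕ} {μ : YoungDiagram}

/-! ### Cells and consecutive entries of standard tableaux. -/

namespace Tableau

theorem entry_pos (T : Tableau n μ) (k : Fin n) : T.entry (T.pos k) = k :=
  Equiv.apply_symm_apply T k

theorem pos_entry (T : Tableau n μ) (c : {c : ℕ × ℕ // c ∈ μ.cells}) : T.pos (T.entry c) = c :=
  Equiv.symm_apply_apply T c

theorem eq_of_row_eq_of_col_eq (T : Tableau n μ) {j k : Fin n} (hr : T.row j = T.row k)
    (hc : T.col j = T.col k) : j = k := by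
  have : T.pos j = T.pos k := Subtype.ext (Prod.ext hr hc)
  rw [← T.entry_pos j, this, T.entry_pos]

theorem row_col_mem (T : Tableau n μ) (k : Fin n) : (T.row k, T.col k) ∈ μ :=
  (YoungDiagram.mem_cells _).mp (T.pos k).2

theorem exists_entry (T : Tableau n μ) {r c : ℕ} (h : (r, c) ∈ μ) :
    ∃ k, T.row k = r ∧ T.col k = c := by
  refine ⟨T.entry ⟨(r, c), (YoungDiagram.mem_cells _).mpr h⟩, ?_, ?_⟩ <;>
    simp [row, col, pos_entry]

theorem exists_entry_of_le (T : Tableau n μ) {r c : ℕ} {k : Fin n} (hr : r ≤ T.row k)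
    (hc : c ≤ T.col k) : ∃ l, T.row l = r ∧ T.col l = c :=
  T.exists_entry (μ.up_left_mem hr hc (T.row_col_mem k))

theorem ext_row_col {S T : Tableau n μ} (hr : ∀ k, S.row k = T.row k)
    (hc : ∀ k, S.col k = T.col k) : S = T := by
  refine Equiv.symm_bijective.injective (Equiv.ext fun k => ?_)
  exact Subtype.ext (Prod.ext (hr k) (hc k))

/-- A tableau is standard exactly if its filling is a linear extension of the cell order. -/
theorem isStandard_iff (T : Tableau n μ) :
    T.IsStandard ↔ ∀ j k, T.row j ≤ T.row k → T.col j ≤ T.col k → j ≤ k := by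
  constructor
  · rintro ⟨h1, h2⟩ j k hr hc
    obtain ⟨l, hlr, hlc⟩ := T.exists_entry_of_le (r := T.row j) (c := T.col k) hr le_rfl
    have hjl : j ≤ l := by
      rcases hc.eq_or_lt with hc | hc
      · exact (T.eq_of_row_eq_of_col_eq hlr.symm (hc.trans hlc.symm)).le
      · have := h1 (T.pos j) (T.pos l) hlr.symm (hc.trans_eq hlc.symm)
        rw [entry_pos, entry_pos] at this
        exact this.le
    have hlk : l ≤ k := by
      rcases hr.eq_or_lt with hr | hr
      · exact (T.eq_of_row_eq_of_col_eq (hlr.trans hr) hlc).le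
      · have := h2 (T.pos l) (T.pos k) hlc (hlr.trans_lt hr)
        rw [entry_pos, entry_pos] at this
        exact this.le
    exact hjl.trans hlk
  · intro h
    constructor
    · intro c d hr hc
      refine lt_of_le_of_ne (h _ _ ?_ ?_) ?_
      · simp [row, pos_entry, hr]
      · simp [col, pos_entry, hc.le]
      · intro he
        have := congrArg T.pos he
        rw [pos_entry, pos_entry] at this
        simp [this] at hc
    · intro c d hc hr
      refine lt_of_le_of_ne (h _ _ ?_ ?_) ?_
      · simp [row, pos_entry, hr.le]
      · simp [col, pos_entry, hc]
      · intro he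
        have := congrArg T.pos he
        rw [pos_entry, pos_entry] at this
        simp [this] at hr

theorem row_swap_left (T : Tableau n μ) (a b : Fin n) :
    (Equiv.swap a b • T).row a = T.row b := by
  rw [row_smul, Equiv.swap_inv, Equiv.swap_apply_left]

theorem row_swap_right (T : Tableau n μ) (a b : Fin n) :
    (Equiv.swap a b • T).row b = T.row a := by
  rw [row_smul, Equiv.swap_inv, Equiv.swap_apply_right]

theorem row_swap_of_ne (T : Tableau n μ) {a b k : Fin n} (ha : k ≠ a) (hb : k ≠ b) :
    (Equiv.swap a b • T).row k = T.row k := by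
  rw [row_smul, Equiv.swap_inv, Equiv.swap_apply_of_ne_of_ne ha hb]

theorem col_swap_left (T : Tableau n μ) (a b : Fin n) :
    (Equiv.swap a b • T).col a = T.col b := by
  rw [col_smul, Equiv.swap_inv, Equiv.swap_apply_left]

theorem col_swap_right (T : Tableau n μ) (a b : Fin n) :
    (Equiv.swap a b • T).col b = T.col a := by
  rw [col_smul, Equiv.swap_inv, Equiv.swap_apply_right]

theorem swap_smul_swap_smul (T : Tableau n μ) (a b : Fin n) :
    Equiv.swap a b • Equiv.swap a b • T = T := by
  rw [smul_smul, Equiv.swap_mul_self, one_smul]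

theorem row_ne_of_col_eq (T : Tableau n μ) {a b : Fin n} (h : a ≠ b) (hc : T.col a = T.col b) :
    T.row a ≠ T.row b := fun hr => h (T.eq_of_row_eq_of_col_eq hr hc)

namespace IsStandard

variable {S T : Tableau n μ}

theorem le (hT : T.IsStandard) {j k : Fin n} (hr : T.row j ≤ T.row k) (hc : T.col j ≤ T.col k) :
    j ≤ k := (isStandard_iff T).mp hT j k hr hc

/-- A cell between those of `a` and `b` would hold an entry strictly between two consecutive
numbers. The same argument drives the next two lemmas. -/
theorem col_succ_of_row_eq (hT : T.IsStandard) {a b : Fin n} (hab : (a : ℕ) + 1 = b)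
    (hr : T.row a = T.row b) : T.col b = T.col a + 1 := by
  have h1 : T.col a < T.col b := by
    by_contra h
    have := hT.le hr.ge (not_lt.mp h)
    omega
  by_contra h2
  obtain ⟨l, hlr, hlc⟩ := T.exists_entry_of_le (r := T.row b) (c := T.col a + 1) (k := b) le_rfl
    (by omega)
  have h3 := hT.le (j := a) (k := l) (by omega) (by omega)
  have h4 := hT.le (j := l) (k := b) (by omega) (by omega)
  have h5 : l ≠ a := by rintro rfl; omega
  have h6 : l ≠ b := by rintro rfl; omega
  omega

theorem row_succ_of_col_eq (hT : T.IsStandard) {a b : Fin n} (hab : (a : ℕ) + 1 = b)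
    (hc : T.col a = T.col b) : T.row b = T.row a + 1 := by
  have h1 : T.row a < T.row b := by
    by_contra h
    have := hT.le (not_lt.mp h) hc.ge
    omega
  by_contra h2
  obtain ⟨l, hlr, hlc⟩ := T.exists_entry_of_le (r := T.row a + 1) (c := T.col b) (k := b)
    (by omega) le_rfl
  have h3 := hT.le (j := a) (k := l) (by omega) (by omega)
  have h4 := hT.le (j := l) (k := b) (by omega) (by omega)
  have h5 : l ≠ a := by rintro rfl; omega
  have h6 : l ≠ b := by rintro rfl; omega
  omega

/-- Consecutive entries in different rows and columns lie in an antidiagonal position. -/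
theorem antidiagonal (hT : T.IsStandard) {a b : Fin n} (hab : (a : ℕ) + 1 = b)
    (hr : T.row a ≠ T.row b) (hc : T.col a ≠ T.col b) :
    (T.row b < T.row a ∧ T.col a < T.col b) ∨ (T.row a < T.row b ∧ T.col b < T.col a) := by
  rcases lt_or_gt_of_ne hr with hr | hr <;> rcases lt_or_gt_of_ne hc with hc | hc
  · exfalso
    obtain ⟨l, hlr, hlc⟩ := T.exists_entry_of_le (r := T.row a) (c := T.col b) (k := b)
      hr.le le_rfl
    have h3 := hT.le (j := a) (k := l) (by omega) (by omega)
    have h4 := hT.le (j := l) (k := b) (by omega) (by omega)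
    have h5 : l ≠ a := by rintro rfl; omega
    have h6 : l ≠ b := by rintro rfl; omega
    omega
  · exact Or.inr ⟨hr, hc⟩
  · exact Or.inl ⟨hr, hc⟩
  · exfalso
    have := hT.le hr.le hc.le
    omega

theorem swap_smul (hT : T.IsStandard) {a b : Fin n} (hab : (a : ℕ) + 1 = b)
    (hr : T.row a ≠ T.row b) (hc : T.col a ≠ T.col b) : (Equiv.swap a b • T).IsStandard := by
  rw [isStandard_iff]
  intro j k h1 h2
  rw [row_smul, row_smul, Equiv.swap_inv] at h1
  rw [col_smul, col_smul, Equiv.swap_inv] at h2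
  have h3 := hT.le h1 h2
  have h4 := hT.antidiagonal hab hr hc
  rw [Equiv.swap_apply_def, Equiv.swap_apply_def] at h3
  -- Exchanging consecutive numbers reverses only their own comparison, and the antidiagonal
  -- position makes their two cells incomparable.
  by_cases hjb : j = b <;> by_cases hka : k = a
  · subst hjb hka
    rw [Equiv.swap_apply_left, Equiv.swap_apply_right] at h1 h2
    omega
  all_goals split_ifs at h3 <;> omega

theorem row_ne_and_col_ne_of_swap (hT : T.IsStandard) {a b : Fin n} (hab : (a : ℕ) + 1 = b)
    (hs : (Equiv.swap a b • T).IsStandard) : T.row a ≠ T.row b ∧ T.col a ≠ T.col b := by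
  constructor
  · intro h
    have h1 := hT.col_succ_of_row_eq hab h
    have := hs.le (j := b) (k := a) (by rw [row_swap_left, row_swap_right, h])
      (by rw [col_swap_left, col_swap_right]; omega)
    omega
  · intro h
    have h1 := hT.row_succ_of_col_eq hab h
    have := hs.le (j := b) (k := a) (by rw [row_swap_left, row_swap_right]; omega)
      (by rw [col_swap_left, col_swap_right, h])
    omega

/-- The rows of the entries `≥ l` of a standard tableau determine the column of `l`. -/
theorem col_eq_of_row_eq (hS : S.IsStandard) (hT : T.IsStandard) {l : Fin n}
    (h : ∀ l', l ≤ l' → S.row l' = T.row l') : S.col l = T.col l := by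
  induction l using WellFoundedGT.induction with
  | ind l ih =>
    -- If `l` were further left in `S` than in `T`, the entry `m` of `S` in the cell that `l`
    -- occupies in `T` would exceed `l`. Both tableaux then agree on `m`, so `m` and `l` would share
    -- a cell of `T`.
    have key : ∀ S T : Tableau n μ, S.IsStandard →
        (∀ l', l ≤ l' → S.row l' = T.row l') →
        (∀ l', l < l' → S.col l' = T.col l') → ¬ S.col l < T.col l := by
      intro S T hS hr hc hlt
      obtain ⟨m, hmr, hmc⟩ := S.exists_entry (T.row_col_mem l)
      have h1 := hS.le (j := l) (k := m) (by rw [hmr, hr l le_rfl]) (by omega)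
      have h2 : l ≠ m := by rintro rfl; omega
      have h3 := lt_of_le_of_ne h1 h2
      exact h2 (T.eq_of_row_eq_of_col_eq (by rw [← hmr, hr m h1]) (by rw [← hmc, hc m h3]))
    have hc : ∀ l', l < l' → S.col l' = T.col l' := fun l' h' =>
      ih l' h' fun l'' h'' => h l'' (h'.le.trans h'')
    have h1 := key S T hS h hc
    have h2 := key T S hT (fun l' h' => (h l' h').symm) (fun l' h' => (hc l' h').symm)
    omega

end IsStandard

/-! ### Dominance order on tableaux. -/

/-- The number of entries `≥ m` in the rows `≥ r`. -/
def cornerCount (T : Tableau n μ) (m r : ℕ) : ℕ :=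
  (Finset.univ.filter fun k : Fin n => m ≤ k ∧ r ≤ T.row k).card

/-- The dominance order on tableaux. -/
def Dominated (S T : Tableau n μ) : Prop := ∀ m r, S.cornerCount m r ≤ T.cornerCount m r

theorem Dominated.refl (T : Tableau n μ) : T.Dominated T := fun _ _ => le_rfl

theorem Dominated.trans {R S T : Tableau n μ} (h : R.Dominated S) (h' : S.Dominated T) :
    R.Dominated T := fun m r => (h m r).trans (h' m r)

theorem cornerCount_eq_add (T : Tableau n μ) (a : Fin n) (r : ℕ) :
    T.cornerCount a r = T.cornerCount (a + 1) r + if r ≤ T.row a then 1 else 0 := by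
  unfold cornerCount
  split_ifs with h
  · rw [← Finset.card_insert_of_notMem (a := a) (by simp)]
    congr 1
    ext k
    simp only [Finset.mem_filter, Finset.mem_univ, true_and, Finset.mem_insert]
    constructor
    · rintro ⟨h1, h2⟩
      by_cases hk : k = a
      · exact Or.inl hk
      · exact Or.inr ⟨by omega, h2⟩
    · rintro (rfl | ⟨h1, h2⟩)
      · exact ⟨le_rfl, h⟩
      · exact ⟨by omega, h2⟩
  · rw [add_zero]
    congr 1
    ext k
    simp only [Finset.mem_filter, Finset.mem_univ, true_and]
    constructor
    · rintro ⟨h1, h2⟩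
      have hk : k ≠ a := by rintro rfl; exact h h2
      exact ⟨by omega, h2⟩
    · rintro ⟨h1, h2⟩
      exact ⟨by omega, h2⟩

/-- The transposition of `a` and `a + 1` preserves the set of entries `≥ m` for every threshold
except `m = a + 1`. -/
theorem cornerCount_swap (T : Tableau n μ) {a b : Fin n} (hab : (a : ℕ) + 1 = b) {m : ℕ}
    (hm : m ≠ b) (r : ℕ) : (Equiv.swap a b • T).cornerCount m r = T.cornerCount m r := by
  unfold cornerCount
  refine Finset.card_bij' (fun k _ => Equiv.swap a b k) (fun k _ => Equiv.swap a b k) ?_ ?_ ?_ ?_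
  · intro k hk
    simp only [Finset.mem_filter, Finset.mem_univ, true_and] at hk ⊢
    refine ⟨?_, by rw [row_smul, Equiv.swap_inv] at hk; exact hk.2⟩
    rw [Equiv.swap_apply_def]
    split_ifs <;> omega
  · intro k hk
    simp only [Finset.mem_filter, Finset.mem_univ, true_and] at hk ⊢
    refine ⟨?_, by rw [row_smul, Equiv.swap_inv, Equiv.swap_apply_self]; exact hk.2⟩
    rw [Equiv.swap_apply_def]
    split_ifs <;> omega
  · intro k _; simp
  · intro k _; simp

/-- A lifting property as in Bruhat order. Only the threshold `b` can fail, and there the inequality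
is forced by those at the neighbouring thresholds `a` and `b + 1`. -/
theorem Dominated.swap_smul {S T : Tableau n μ} {a b : Fin n} (hab : (a : ℕ) + 1 = b)
    (hr : T.row a ≤ T.row b) (h : S.Dominated T) : (Equiv.swap a b • S).Dominated T := by
  intro m r
  by_cases hm : m = b
  · subst hm
    have e1 := cornerCount_eq_add (Equiv.swap a b • S) b r
    have e2 := cornerCount_eq_add T b r
    have e3 := cornerCount_eq_add (Equiv.swap a b • S) a r
    have e4 := cornerCount_eq_add T a r
    rw [cornerCount_swap S hab (m := b + 1) (by omega)] at e1
    rw [cornerCount_swap S hab (m := a) (by omega)] at e3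
    rw [hab] at e3 e4
    have h1 := h (b + 1) r
    have h2 := h a r
    split_ifs at e1 e2 e3 e4 <;> omega
  · rw [cornerCount_swap S hab hm]
    exact h m r

theorem dominated_swap_smul {T : Tableau n μ} {a b : Fin n} (hab : (a : ℕ) + 1 = b)
    (hr : T.row b ≤ T.row a) : T.Dominated (Equiv.swap a b • T) := by
  have := (Dominated.refl (Equiv.swap a b • T)).swap_smul hab
    (by rwa [row_swap_left, row_swap_right])
  rwa [swap_smul_swap_smul] at this

theorem Dominated.swap_smul_swap_smul {S T : Tableau n μ} {a b : Fin n} (hab : (a : ℕ) + 1 = b)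
    (hr : T.row b ≤ T.row a) (h : S.Dominated T) :
    (Equiv.swap a b • S).Dominated (Equiv.swap a b • T) :=
  (h.trans (dominated_swap_smul hab hr)).swap_smul hab (by rwa [row_swap_left, row_swap_right])

end Tableau

/-! ### The last letter order is total and refines dominance. -/

namespace Std

theorem lt_irrefl (T : Std n μ) : ¬ T < T := fun ⟨_, h, _⟩ => h.false

theorem lt_trans {R S T : Std n μ} (h : R < S) (h' : S < T) : R < T := by
  obtain ⟨k, hk, hk'⟩ := h
  obtain ⟨l, hl, hl'⟩ := h'
  rcases lt_trichotomy k l with h | rfl | h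
  · exact ⟨l, by rwa [hk' l h], fun m hm => by rw [hk' m (h.trans hm), hl' m hm]⟩
  · exact ⟨k, hk.trans hl, fun m hm => by rw [hk' m hm, hl' m hm]⟩
  · exact ⟨k, by rwa [← hl' k h], fun m hm => by rw [hk' m hm, hl' m (h.trans hm)]⟩

theorem ext_row {S T : Std n μ} (h : ∀ k, S.1.row k = T.1.row k) : S = T :=
  Subtype.ext (Tableau.ext_row_col h fun _ => S.2.col_eq_of_row_eq T.2 fun l' _ => h l')

theorem lt_or_eq_or_gt (S T : Std n μ) : S < T ∨ S = T ∨ T < S := by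
  by_cases h : ∀ k, S.1.row k = T.1.row k
  · exact Or.inr (Or.inl (ext_row h))
  · push Not at h
    obtain ⟨k, hk, hmax⟩ := (Finset.univ.filter fun k => S.1.row k ≠ T.1.row k).exists_maximal
      (by obtain ⟨k, hk⟩ := h; exact ⟨k, by simpa using hk⟩)
    have hk : S.1.row k ≠ T.1.row k := by simpa using hk
    have hmax' : ∀ l, k < l → S.1.row l = T.1.row l := by
      intro l hl
      by_contra hne
      exact absurd (hmax (by simpa using hne) hl.le) (not_le.mpr hl)
    rcases lt_or_gt_of_ne hk with hk | hk
    · exact Or.inl ⟨k, hk, hmax'⟩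
    · exact Or.inr (Or.inr ⟨k, hk, fun l hl => (hmax' l hl).symm⟩)

theorem wellFounded_lt : WellFounded fun S T : Std n μ => S < T :=
  haveI : IsTrans (Std n μ) fun S T => S < T := ⟨fun _ _ _ => lt_trans⟩
  haveI : Std.Irrefl fun S T : Std n μ => S < T := ⟨lt_irrefl⟩
  Finite.wellFounded_of_trans_of_irrefl _

theorem wellFounded_gt : WellFounded fun S T : Std n μ => T < S :=
  haveI : IsTrans (Std n μ) fun S T => T < S := ⟨fun _ _ _ h h' => lt_trans h' h⟩
  haveI : Std.Irrefl fun S T : Std n μ => T < S := ⟨lt_irrefl⟩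
  Finite.wellFounded_of_trans_of_irrefl _

/-- At the last letter `k` where the rows differ, the counts for threshold `k + 1` agree, so the
count for threshold `k` and row `S.1.row k` is larger in `S`. -/
theorem not_lt_of_dominated {S T : Std n μ} (h : S.1.Dominated T.1) : ¬ T < S := by
  rintro ⟨k, hk, hk'⟩
  have e1 := S.1.cornerCount_eq_add k (S.1.row k)
  have e2 := T.1.cornerCount_eq_add k (S.1.row k)
  have e3 : S.1.cornerCount (k + 1) (S.1.row k) = T.1.cornerCount (k + 1) (S.1.row k) := by
    unfold Tableau.cornerCount
    congr 1
    ext l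
    simp only [Finset.mem_filter, Finset.mem_univ, true_and]
    refine and_congr_right fun hl => ?_
    rw [hk' l (by omega)]
  have := h k (S.1.row k)
  split_ifs at e1 e2 <;> omega

theorem lt_of_dominated {S T : Std n μ} (h : S.1.Dominated T.1) (hne : S ≠ T) : S < T := by
  have := not_lt_of_dominated h
  rcases lt_or_eq_or_gt S T with h | h | h
  · exact h
  · exact absurd h hne
  · exact absurd h this

end Std

/-! ### Polytabloids and linear independence of the standard ones. -/

theorem polytabloid_smul_of_mem_colStabilizer {T : Tableau n μ} {τ : Equiv.Perm (Fin n)}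
    (hτ : τ ∈ T.colStabilizer) :
    polytabloid (τ • T) = ((Equiv.Perm.sign τ : ℤ) : ℝ) • polytabloid T := by
  rw [← permRep_polytabloid]
  unfold polytabloid
  rw [map_sum, Finset.smul_sum]
  refine Finset.sum_bij' (fun σ _ => τ * σ) (fun σ _ => τ⁻¹ * σ) ?_ ?_ ?_ ?_ ?_
  · intro σ hσ
    simp only [Finset.mem_filter, Finset.mem_univ, true_and] at hσ ⊢
    exact mul_mem hτ hσ
  · intro σ hσ
    simp only [Finset.mem_filter, Finset.mem_univ, true_and] at hσ ⊢
    exact mul_mem (inv_mem hτ) hσ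
  · intro σ _; simp
  · intro σ _; simp
  · intro σ _
    rw [map_smul, smul_smul, map_mul (permRep n μ), Equiv.Perm.sign_mul]
    congr 1
    rcases Int.units_eq_one_or (Equiv.Perm.sign τ) with h | h <;> simp [h]

theorem polytabloid_smul (σ : Equiv.Perm (Fin n)) (T : Tableau n μ) :
    polytabloid (σ • T) = ∑ τ : Equiv.Perm (Fin n) with τ ∈ T.colStabilizer,
      ((Equiv.Perm.sign τ : ℤ) : ℝ) • Finsupp.single (tabloid (σ • τ • T)) 1 := by
  rw [← permRep_polytabloid, polytabloid, map_sum]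
  refine Finset.sum_congr rfl fun τ _ => ?_
  rw [map_smul, permRep_single, permRep_single, smul_tabloid, smul_tabloid]

theorem swap_mem_colStabilizer {T : Tableau n μ} {a b : Fin n} (h : T.col a = T.col b) :
    Equiv.swap a b ∈ T.colStabilizer := by
  intro k
  rw [Equiv.swap_apply_def]
  split_ifs with h1 h2
  · rw [h1, h]
  · rw [h2, h]
  · rfl

theorem polytabloid_swap_of_col_eq {T : Tableau n μ} {a b : Fin n} (hab : a ≠ b)
    (h : T.col a = T.col b) : polytabloid (Equiv.swap a b • T) = - polytabloid T := by
  rw [polytabloid_smul_of_mem_colStabilizer (swap_mem_colStabilizer h), Equiv.Perm.sign_swap hab]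
  simp

theorem tabloid_eq_iff {S T : Tableau n μ} : tabloid S = tabloid T ↔ ∀ k, S.row k = T.row k := by
  exact Quotient.eq.trans ((Tableau.equiv_iff_row S T).trans funext_iff)

theorem tabloid_swap_of_row_eq {T : Tableau n μ} {p q : Fin n} (h : T.row p = T.row q) :
    tabloid (Equiv.swap p q • T) = tabloid T := by
  rw [tabloid_eq_iff]
  intro k
  rw [Tableau.row_smul, Equiv.swap_inv, Equiv.swap_apply_def]
  split_ifs with h1 h2
  · rw [h1, h]
  · rw [h2, h]
  · rfl

open Classical in
theorem polytabloid_apply (T : Tableau n μ) (t : Tabloid n μ) :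
    polytabloid T t = ∑ σ : Equiv.Perm (Fin n) with σ ∈ T.colStabilizer,
      if tabloid (σ • T) = t then ((Equiv.Perm.sign σ : ℤ) : ℝ) else 0 := by
  unfold polytabloid
  rw [Finsupp.finsetSum_apply]
  refine Finset.sum_congr rfl fun σ _ => ?_
  rw [permRep_single, smul_tabloid, Finsupp.smul_apply, Finsupp.single_apply]
  split_ifs <;> simp

theorem eq_one_of_tabloid_smul_eq {T : Tableau n μ} {σ : Equiv.Perm (Fin n)}
    (hσ : σ ∈ T.colStabilizer) (h : tabloid (σ • T) = tabloid T) : σ = 1 := by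
  rw [tabloid_eq_iff] at h
  refine inv_eq_one.mp (Equiv.ext fun k => ?_)
  exact T.eq_of_row_eq_of_col_eq (h k) (inv_mem hσ k)

theorem polytabloid_apply_self (T : Tableau n μ) : polytabloid T (tabloid T) = 1 := by
  classical
  rw [polytabloid_apply, Finset.sum_eq_single 1]
  · simp
  · intro σ hσ hne
    rw [if_neg]
    exact fun h => hne (eq_one_of_tabloid_smul_eq (by simpa using hσ) h)
  · intro h
    exact absurd (by simp [one_mem]) h

/-- A column permutation of `S` replaces its largest moved entry `k` by moving it to the cell of the
smaller entry `σ⁻¹ k`, which is higher up in the same column. Every other tabloid of a standard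
tableau occurring in the polytabloid of `S` is therefore smaller in the last letter order. -/
theorem polytabloid_apply_eq_zero {S T : Std n μ} (hne : S ≠ T) (hlt : ¬ T < S) :
    polytabloid S.1 (tabloid T.1) = 0 := by
  classical
  rw [polytabloid_apply]
  refine Finset.sum_eq_zero fun σ hσ => if_neg fun h => ?_
  have hσ : σ⁻¹ ∈ S.1.colStabilizer := inv_mem (by simpa using hσ)
  rw [tabloid_eq_iff] at h
  obtain ⟨k, hk, hkl⟩ : ∃ k, σ⁻¹ k ≠ k ∧ ∀ l, k < l → σ⁻¹ l = l := by
    have hex : ∃ k, σ⁻¹ k ≠ k := by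
      by_contra! hall
      exact hne (Std.ext_row fun k => by rw [← h k, Tableau.row_smul, hall])
    obtain ⟨k, hk, hmax⟩ := (Finset.univ.filter fun k => σ⁻¹ k ≠ k).exists_maximal
      (by obtain ⟨k, hk⟩ := hex; exact ⟨k, by simpa using hk⟩)
    refine ⟨k, by simpa using hk, fun l hl => ?_⟩
    by_contra hl'
    exact absurd (hmax (by simpa using hl') hl.le) (not_le.mpr hl)
  have hlt' : σ⁻¹ k < k := by
    refine lt_of_le_of_ne (not_lt.mp fun hgt => ?_) hk
    exact hk (σ⁻¹.injective (hkl _ hgt))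
  refine hlt ⟨k, ?_, fun l hl => by rw [← h l, Tableau.row_smul, hkl l hl]⟩
  rw [← h k, Tableau.row_smul]
  by_contra hge
  exact absurd (S.2.le (not_lt.mp hge) (hσ k).ge) (not_le.mpr hlt')

theorem linearIndependent_polytabloid :
    LinearIndependent ℝ fun T : Std n μ => polytabloid T.1 := by
  rw [Fintype.linearIndependent_iff]
  intro g hg T
  induction T using Std.wellFounded_gt.induction with
  | _ T ih =>
    have h := DFunLike.congr_fun hg (tabloid T.1)
    rw [Finsupp.finsetSum_apply, Finset.sum_eq_single T] at h
    · simpa [polytabloid_apply_self] using h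
    · intro S _ hne
      rcases Std.lt_or_eq_or_gt S T with hlt | heq | hgt
      · rw [Finsupp.smul_apply, polytabloid_apply_eq_zero hne, smul_zero]
        exact fun h' => Std.lt_irrefl S (Std.lt_trans hlt h')
      · exact absurd heq hne
      · rw [ih S hgt, zero_smul]; rfl
    · exact fun h => absurd (Finset.mem_univ T) h

/-! ### Garnir relations and straightening. -/

/-- The entries of `T` in column `c` in the rows `≥ r` and in column `d` in the rows `≤ r`. -/
def garnirSet (T : Tableau n μ) (r c d : ℕ) : Finset (Fin n) :=
  Finset.univ.filter fun k => (T.col k = c ∧ r ≤ T.row k) ∨ (T.col k = d ∧ T.row k ≤ r)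

/-- Column `c` contributes `μ.colLen c - r` entries and column `d` contributes `r + 1`: one more
than there are rows, ready for the pigeonhole principle. -/
theorem colLen_lt_card_garnirSet (T : Tableau n μ) {r c d : ℕ} (hcd : c < d) (hrd : (r, d) ∈ μ) :
    μ.colLen c < (garnirSet T r c d).card := by
  have hr : r < μ.colLen c :=
    (YoungDiagram.mem_iff_lt_colLen).mp (μ.up_left_mem le_rfl hcd.le hrd)
  have hA : (Finset.Ico r (μ.colLen c)).card ≤
      (Finset.univ.filter fun k => T.col k = c ∧ r ≤ T.row k).card := by
    refine Finset.card_le_card_of_surjOn T.row fun i hi => ?_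
    rw [Finset.coe_Ico, Set.mem_Ico] at hi
    obtain ⟨k, hk, hk'⟩ := T.exists_entry (YoungDiagram.mem_iff_lt_colLen.mpr hi.2)
    exact ⟨k, by simp [hk', hk, hi.1], hk⟩
  have hB : (Finset.range (r + 1)).card ≤
      (Finset.univ.filter fun k => T.col k = d ∧ T.row k ≤ r).card := by
    refine Finset.card_le_card_of_surjOn T.row fun i hi => ?_
    rw [Finset.coe_range, Set.mem_Iio] at hi
    obtain ⟨k, hk, hk'⟩ := T.exists_entry (μ.up_left_mem (Nat.lt_succ_iff.mp hi) le_rfl hrd)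
    exact ⟨k, by simp [hk', hk, Nat.lt_succ_iff.mp hi], hk⟩
  have hdisj : Disjoint (Finset.univ.filter fun k => T.col k = c ∧ r ≤ T.row k)
      (Finset.univ.filter fun k => T.col k = d ∧ T.row k ≤ r) := by
    rw [Finset.disjoint_filter]
    rintro k _ ⟨h1, _⟩ ⟨h2, _⟩
    omega
  rw [garnirSet, Finset.filter_or, Finset.card_union_of_disjoint hdisj]
  rw [Nat.card_Ico] at hA
  rw [Finset.card_range] at hB
  omega

/-- The Garnir relation. -/
theorem sum_sign_polytabloid_garnirSet (T : Tableau n μ) {r c d : ℕ} (hcd : c < d)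
    (hrd : (r, d) ∈ μ) :
    ∑ σ : Equiv.Perm (Fin n) with ∀ k, k ∉ garnirSet T r c d → σ k = k,
      ((Equiv.Perm.sign σ : ℤ) : ℝ) • polytabloid (σ • T) = 0 := by
  simp_rw [polytabloid_smul, Finset.smul_sum]
  rw [Finset.sum_comm]
  refine Finset.sum_eq_zero fun τ hτ => ?_
  have hτ : τ⁻¹ ∈ T.colStabilizer := inv_mem (by simpa using hτ)
  -- After the column permutation `τ` two entries `p`, `q` of the Garnir set share a row. Right
  -- multiplication by their transposition fixes the tabloid and reverses the sign, so the terms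
  -- cancel in pairs.
  obtain ⟨p, hp, q, hq, hpq, hrow⟩ := Finset.exists_ne_map_eq_of_card_lt_of_maps_to
    (s := garnirSet T r c d) (t := Finset.range (μ.colLen c)) (f := (τ • T).row)
    (by rw [Finset.card_range]; exact colLen_lt_card_garnirSet T hcd hrd)
    (by
      intro k hk
      rw [Finset.mem_coe, Finset.mem_range, Tableau.row_smul, ← YoungDiagram.mem_iff_lt_colLen]
      refine μ.up_left_mem le_rfl ?_ (T.row_col_mem (τ⁻¹ k))
      have hk : (T.col k = c ∧ r ≤ T.row k) ∨ (T.col k = d ∧ T.row k ≤ r) := by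
        simpa [garnirSet] using hk
      have := hτ k
      omega)
  have hfix := tabloid_swap_of_row_eq hrow
  refine Finset.sum_involution (fun σ _ => σ * Equiv.swap p q) ?_ ?_ ?_ ?_
  · intro σ _
    rw [mul_smul, ← smul_tabloid σ, ← smul_tabloid σ, hfix, ← add_smul]
    simp [hpq]
  · intro σ _ _ h
    exact hpq (Equiv.swap_eq_one_iff.mp (mul_eq_left.mp h))
  · intro σ hσ
    simp only [Finset.mem_filter, Finset.mem_univ, true_and] at hσ ⊢
    intro k hk
    rw [Equiv.Perm.mul_apply, Equiv.swap_apply_of_ne_of_ne, hσ k hk]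
    · rintro rfl; exact hk hp
    · rintro rfl; exact hk hq
  · intro σ _
    rw [mul_assoc, Equiv.swap_mul_self, mul_one]

theorem exists_mem_apply_notMem {α : Type*} [DecidableEq α] {σ : Equiv.Perm α} {A : Finset α}
    {k : α} (hk : k ∉ A) (hσk : σ k ∈ A) : ∃ l ∈ A, σ l ∉ A := by
  by_contra! h
  have hsub : A.map σ.toEmbedding ⊆ A := by
    intro x hx
    obtain ⟨l, hl, rfl⟩ := Finset.mem_map.mp hx
    exact h l hl
  rw [← Finset.eq_of_subset_of_card_le hsub (by simp)] at hσk
  obtain ⟨l, hl, hlk⟩ := Finset.mem_map.mp hσk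
  exact hk (σ.injective hlk ▸ hl)

/-- Rearrangement inequality: on the Garnir set, entries in the left column are at least `p`,
entries in the right column at most `q < p`. Entries and columns are oppositely ordered, which makes
the sum minimal, strictly so unless columns are preserved. -/
theorem colWeight_lt_of_garnirSet {T : Tableau n μ} {p q : Fin n}
    (hcol : ∀ j k, T.col j = T.col k → T.row j ≤ T.row k → j ≤ k) (hrow : T.row p = T.row q)
    (hc : T.col p < T.col q) (hqp : q < p) {σ : Equiv.Perm (Fin n)}
    (hσ : ∀ k, k ∉ garnirSet T (T.row p) (T.col p) (T.col q) → σ k = k)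
    (hσT : σ ∉ T.colStabilizer) :
    ∑ k : Fin n, (k : ℕ) * T.col k < ∑ k : Fin n, (k : ℕ) * (σ • T).col k := by
  have hmem : ∀ k, k ∈ garnirSet T (T.row p) (T.col p) (T.col q) ↔
      (T.col k = T.col p ∧ T.row p ≤ T.row k) ∨ (T.col k = T.col q ∧ T.row k ≤ T.row p) := by
    intro k; simp [garnirSet]
  have hA : ∀ k ∈ garnirSet T (T.row p) (T.col p) (T.col q), T.col k = T.col p → p ≤ k := by
    intro k hk h
    rcases (hmem k).mp hk with h' | h'
    · exact hcol p k h.symm h'.2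
    · omega
  have hB : ∀ k ∈ garnirSet T (T.row p) (T.col p) (T.col q), T.col k = T.col q → k ≤ q := by
    intro k hk h
    rcases (hmem k).mp hk with h' | h'
    · omega
    · exact hcol k q h (by omega)
  have hAB : ∀ k ∈ garnirSet T (T.row p) (T.col p) (T.col q),
      T.col k = T.col p ∨ T.col k = T.col q := fun k hk =>
    ((hmem k).mp hk).imp And.left And.left
  have hmap : ∀ k ∈ garnirSet T (T.row p) (T.col p) (T.col q),
      σ k ∈ garnirSet T (T.row p) (T.col p) (T.col q) := by
    intro k hk
    by_contra h
    have := σ.injective (hσ _ h)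
    rw [this] at h
    exact h hk
  have hsum : ∑ k : Fin n, (k : ℕ) * (σ • T).col k = ∑ k : Fin n, (σ k : ℕ) * T.col k := by
    refine (Equiv.sum_comp σ fun k : Fin n => (k : ℕ) * (σ • T).col k).symm.trans ?_
    refine Finset.sum_congr rfl fun k _ => ?_
    simp [Tableau.col_smul]
  rw [hsum]
  have hanti : AntivaryOn (fun k : Fin n => (k : ℕ)) T.col
      (garnirSet T (T.row p) (T.col p) (T.col q)) := by
    intro i hi j hj hij
    rcases hAB i hi with hi' | hi' <;> rcases hAB j hj with hj' | hj' <;> try omega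
    have h1 := hA i hi hi'
    have h2 := hB j hj hj'
    show (j : ℕ) ≤ i
    omega
  have hlt := (hanti.sum_mul_lt_sum_comp_perm_mul_iff (σ := σ) (by
    intro k hk
    by_contra h
    exact hk (hσ k h))).mpr ?_
  · rw [← Finset.sum_add_sum_compl (garnirSet T (T.row p) (T.col p) (T.col q)),
      ← Finset.sum_add_sum_compl (garnirSet T (T.row p) (T.col p) (T.col q))
        (fun k => (σ k : ℕ) * T.col k)]
    refine add_lt_add_of_lt_of_le hlt (le_of_eq ?_)
    refine Finset.sum_congr rfl fun k hk => ?_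
    rw [hσ k (Finset.mem_compl.mp hk)]
  · intro hanti'
    obtain ⟨k, hk⟩ : ∃ k, T.col (σ k) ≠ T.col k := by
      by_contra! h
      exact hσT h
    have hkD : k ∈ garnirSet T (T.row p) (T.col p) (T.col q) := by
      by_contra h
      exact hk (by rw [hσ k h])
    -- As `σ` changes some column, finiteness gives an entry `i` crossing from left to right and an
    -- entry `j` crossing back; then `σ i ≤ q < p ≤ σ j` breaks the opposite ordering.
    obtain ⟨i, hi, j, hj, hip, hiq, hjq, hjp⟩ :
        ∃ i ∈ garnirSet T (T.row p) (T.col p) (T.col q),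
          ∃ j ∈ garnirSet T (T.row p) (T.col p) (T.col q), T.col i = T.col p ∧
            T.col (σ i) = T.col q ∧ T.col j = T.col q ∧ T.col (σ j) = T.col p := by
      rcases hAB k hkD with h | h
      · have h' := (hAB _ (hmap k hkD)).resolve_left (h ▸ hk)
        obtain ⟨l, hl, hl'⟩ := exists_mem_apply_notMem (σ := σ) (k := k)
          (A := (garnirSet T (T.row p) (T.col p) (T.col q)).filter fun l => T.col l = T.col q)
          (by simp [h, hc.ne]) (by simp [h', hmap k hkD])
        rw [Finset.mem_filter] at hl
        have := hmap l hl.1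
        exact ⟨k, hkD, l, hl.1, h, h', hl.2,
          (hAB _ this).resolve_right fun h => hl' (Finset.mem_filter.mpr ⟨this, h⟩)⟩
      · have h' := (hAB _ (hmap k hkD)).resolve_right (h ▸ hk)
        obtain ⟨l, hl, hl'⟩ := exists_mem_apply_notMem (σ := σ) (k := k)
          (A := (garnirSet T (T.row p) (T.col p) (T.col q)).filter fun l => T.col l = T.col p)
          (by simp [h, hc.ne']) (by simp [h', hmap k hkD])
        rw [Finset.mem_filter] at hl
        have := hmap l hl.1
        exact ⟨l, hl.1, k, hkD, hl.2,
          (hAB _ this).resolve_left fun h => hl' (Finset.mem_filter.mpr ⟨this, h⟩), h, h'⟩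
    have h1 := hanti' hi hj (by omega)
    have h2 := hA _ (hmap j hj) hjp
    have h3 := hB _ (hmap i hi) hiq
    simp only [Function.comp_apply] at h1
    omega

theorem sum_mul_lt_sum_mul_swap {g : Fin n → ℕ} {j k : Fin n} (hjk : j < k) (hg : g k < g j) :
    ∑ i : Fin n, (i : ℕ) * g i < ∑ i : Fin n, (i : ℕ) * g (Equiv.swap j k i) := by
  rw [← Finset.sum_add_sum_compl {j, k},
    ← Finset.sum_add_sum_compl {j, k} fun i : Fin n => (i : ℕ) * g (Equiv.swap j k i)]
  refine add_lt_add_of_lt_of_le ?_ (le_of_eq (Finset.sum_congr rfl fun i hi => ?_))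
  · rw [Finset.sum_pair hjk.ne, Finset.sum_pair hjk.ne, Equiv.swap_apply_left,
      Equiv.swap_apply_right]
    have hjk : (j : ℕ) < k := hjk
    nlinarith
  · simp only [Finset.mem_compl, Finset.mem_insert, Finset.mem_singleton, not_or] at hi
    rw [Equiv.swap_apply_of_ne_of_ne hi.1 hi.2]

/-- Pairs of weights that grow along the straightening procedure. -/
def straighteningWeight (T : Tableau n μ) : ℕ ×ₗ ℕ :=
  toLex (∑ k : Fin n, (k : ℕ) * T.col k, ∑ k : Fin n, (k : ℕ) * T.row k)

theorem wellFounded_straighteningWeight :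
    WellFounded fun S T : Tableau n μ => straighteningWeight T < straighteningWeight S :=
  haveI : IsTrans (Tableau n μ) fun S T => straighteningWeight T < straighteningWeight S :=
    ⟨fun _ _ _ h h' => h'.trans h⟩
  haveI : Std.Irrefl fun S T : Tableau n μ => straighteningWeight T < straighteningWeight S :=
    ⟨fun _ => lt_irrefl _⟩
  Finite.wellFounded_of_trans_of_irrefl _

/-- Straightening: sorting a column keeps the column weight and raises the row weight; if all
columns are sorted, the Garnir relation at a row descent raises the column weight. -/
theorem polytabloid_mem_span_std (T : Tableau n μ) :
    polytabloid T ∈ Submodule.span ℝ (Set.range fun S : Std n μ => polytabloid S.1) := by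
  induction T using wellFounded_straighteningWeight.induction with
  | _ T ih =>
    by_cases hcol : ∀ j k, T.col j = T.col k → T.row j ≤ T.row k → j ≤ k
    · by_cases hstd : T.IsStandard
      · exact Submodule.subset_span ⟨⟨T, hstd⟩, rfl⟩
      · obtain ⟨p, q, hrow, hc, hqp⟩ :
            ∃ p q, T.row p = T.row q ∧ T.col p < T.col q ∧ q < p := by
          by_contra! h
          refine hstd ((Tableau.isStandard_iff T).mpr fun j k hr hc => ?_)
          obtain ⟨l, hlr, hlc⟩ :=
            T.exists_entry_of_le (r := T.row j) (c := T.col k) (k := k) hr le_rfl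
          refine le_trans ?_ (hcol l k hlc (by omega))
          rcases hc.eq_or_lt with hc | hc
          · exact (T.eq_of_row_eq_of_col_eq hlr.symm (hc.trans hlc.symm)).le
          · exact h j l hlr.symm (by omega)
        have hg := sum_sign_polytabloid_garnirSet T hc (r := T.row p)
          (by rw [hrow]; exact T.row_col_mem q)
        -- Column-preserving terms each equal `polytabloid T`, since the sign occurs twice. They
        -- form a positive multiple of it, and all other terms are heavier.
        rw [← Finset.sum_filter_add_sum_filter_not _ (· ∈ T.colStabilizer), Finset.filter_filter,
          Finset.filter_filter] at hg
        have h1 : ∑ σ : Equiv.Perm (Fin n) with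
            (∀ k, k ∉ garnirSet T (T.row p) (T.col p) (T.col q) → σ k = k) ∧
              σ ∈ T.colStabilizer,
            ((Equiv.Perm.sign σ : ℤ) : ℝ) • polytabloid (σ • T) =
          ((Finset.univ.filter fun σ : Equiv.Perm (Fin n) =>
            (∀ k, k ∉ garnirSet T (T.row p) (T.col p) (T.col q) → σ k = k) ∧
              σ ∈ T.colStabilizer).card : ℝ) • polytabloid T := by
          rw [Nat.cast_smul_eq_nsmul ℝ, ← Finset.sum_const]
          refine Finset.sum_congr rfl fun σ hσ => ?_
          rw [polytabloid_smul_of_mem_colStabilizer (Finset.mem_filter.mp hσ).2.2, smul_smul]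
          rcases Int.units_eq_one_or (Equiv.Perm.sign σ) with h | h <;> simp [h]
        rw [h1] at hg
        have hpos : ((Finset.univ.filter fun σ : Equiv.Perm (Fin n) =>
            (∀ k, k ∉ garnirSet T (T.row p) (T.col p) (T.col q) → σ k = k) ∧
              σ ∈ T.colStabilizer).card : ℝ) ≠ 0 := by
          rw [Nat.cast_ne_zero]
          refine Finset.card_ne_zero_of_mem (a := 1) ?_
          simp [one_mem]
        rw [← Submodule.smul_mem_iff _ hpos, eq_neg_of_add_eq_zero_left hg]
        refine Submodule.neg_mem _ (Submodule.sum_mem _ fun σ hσ => Submodule.smul_mem _ _ ?_)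
        refine ih _ (Prod.Lex.toLex_lt_toLex.mpr (Or.inl ?_))
        exact colWeight_lt_of_garnirSet hcol hrow hc hqp (Finset.mem_filter.mp hσ).2.1
          (Finset.mem_filter.mp hσ).2.2
    · push Not at hcol
      obtain ⟨j, k, hc, hr, hkj⟩ := hcol
      have hr' : T.row j < T.row k := lt_of_le_of_ne hr (T.row_ne_of_col_eq hkj.ne' hc)
      have hmem := ih (Equiv.swap k j • T) (Prod.Lex.toLex_lt_toLex.mpr (Or.inr ⟨?_, ?_⟩))
      · rw [polytabloid_swap_of_col_eq hkj.ne hc.symm] at hmem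
        exact (Submodule.neg_mem_iff _).mp hmem
      · dsimp only
        refine Finset.sum_congr rfl fun i _ => ?_
        have := inv_mem (swap_mem_colStabilizer hc.symm) i
        rw [Tableau.col_smul]
        exact congrArg _ this.symm
      · exact sum_mul_lt_sum_mul_swap hkj hr'

theorem span_polytabloid_std :
    Submodule.span ℝ (Set.range fun S : Std n μ => polytabloid S.1) = Specht n μ := by
  refine le_antisymm (Submodule.span_mono ?_) (Submodule.span_le.mpr ?_)
  · rintro _ ⟨S, rfl⟩
    exact ⟨S.1, rfl⟩
  · rintro _ ⟨T, rfl⟩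
    exact polytabloid_mem_span_std T

/-- The polytabloid of `T` as an element of the Specht module. -/
noncomputable def spechtVector (T : Tableau n μ) : Specht n μ :=
  ⟨polytabloid T, Submodule.subset_span ⟨T, rfl⟩⟩

theorem spechtRep_spechtVector (σ : Equiv.Perm (Fin n)) (T : Tableau n μ) :
    spechtRep n μ σ (spechtVector T) = spechtVector (σ • T) :=
  Subtype.ext (permRep_polytabloid σ T)

theorem spechtVector_swap_of_col_eq {T : Tableau n μ} {a b : Fin n} (hab : a ≠ b)
    (h : T.col a = T.col b) : spechtVector (Equiv.swap a b • T) = - spechtVector T :=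
  Subtype.ext (polytabloid_swap_of_col_eq hab h)

/-- The basis of the Specht module consisting of the standard polytabloids. -/
noncomputable def polytabloidBasis (n : ℕ) (μ : YoungDiagram) :
    Basis (Std n μ) ℝ (Specht n μ) :=
  (Basis.span linearIndependent_polytabloid).map (LinearEquiv.ofEq _ _ span_polytabloid_std)

theorem polytabloidBasis_apply (T : Std n μ) :
    polytabloidBasis n μ T = spechtVector T.1 := by
  refine Subtype.ext ?_
  simp [polytabloidBasis, spechtVector, Basis.span_apply]

/-! ### Jucys–Murphy elements and their eigenvectors. -/

/-- Exchanging an entry with all entries of a column further left. -/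
theorem sum_polytabloid_swap (T : Tableau n μ) {k : Fin n} {c : ℕ} (hc : c < T.col k) :
    ∑ j : Fin n with T.col j = c, polytabloid (Equiv.swap j k • T) = polytabloid T := by
  -- Let `a τ` be the entry of column `c` in the row of `k` in `τ • T`. The terms with `j = a τ`
  -- leave the tabloid unchanged and add up to the polytabloid; the others must cancel.
  have hex : ∀ τ ∈ T.colStabilizer, ∃ a : Fin n, (τ • T).row a = (τ • T).row k ∧ T.col a = c := by
    intro τ hτ
    obtain ⟨a, ha, hac⟩ := (τ • T).exists_entry_of_le (r := (τ • T).row k) (c := c) (k := k) le_rfl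
      (by rw [Tableau.col_smul, inv_mem hτ k]; exact hc.le)
    exact ⟨a, ha, by rw [← hac, Tableau.col_smul, inv_mem hτ a]⟩
  have : Nonempty (Fin n) := ⟨k⟩
  choose! a har hac using hex
  have hak : ∀ {j}, T.col j = c → j ≠ k := by rintro j hj rfl; omega
  have huniq : ∀ τ ∈ T.colStabilizer, ∀ j, T.col j = c → (τ • T).row j = (τ • T).row k →
      j = a τ := by
    intro τ hτ j hj hr
    refine (τ • T).eq_of_row_eq_of_col_eq (hr.trans (har τ hτ).symm) ?_
    rw [Tableau.col_smul, Tableau.col_smul, inv_mem hτ, inv_mem hτ, hj, hac τ hτ]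
  have hsplit : ∀ τ ∈ T.colStabilizer, ∑ j : Fin n with T.col j = c,
      ((Equiv.Perm.sign τ : ℤ) : ℝ) •
        (Finsupp.single (tabloid (Equiv.swap j k • τ • T)) 1 : PermModule n μ) =
      ((Equiv.Perm.sign τ : ℤ) : ℝ) • Finsupp.single (tabloid (τ • T)) 1 +
      ∑ j ∈ (Finset.univ.filter fun j => T.col j = c).erase (a τ),
        ((Equiv.Perm.sign τ : ℤ) : ℝ) •
          Finsupp.single (tabloid (Equiv.swap j k • τ • T)) 1 := by
    intro τ hτ
    rw [← Finset.add_sum_erase _ _ (a := a τ) (by simpa using hac τ hτ),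
      tabloid_swap_of_row_eq (har τ hτ)]
  simp_rw [polytabloid_smul]
  rw [Finset.sum_comm, Finset.sum_congr rfl fun τ hτ => hsplit τ (Finset.mem_filter.mp hτ).2,
    Finset.sum_add_distrib]
  have h0 := polytabloid_smul 1 T
  simp only [one_smul] at h0
  rw [h0, add_eq_left, Finset.sum_sigma']
  have hmem : ∀ p : (_ : Equiv.Perm (Fin n)) × Fin n,
      p ∈ (Finset.univ.filter fun τ => τ ∈ T.colStabilizer).sigma
        (fun τ => (Finset.univ.filter fun j => T.col j = c).erase (a τ)) ↔
      p.1 ∈ T.colStabilizer ∧ p.2 ≠ a p.1 ∧ T.col p.2 = c := by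
    intro p; simp
  have hswap : ∀ τ ∈ T.colStabilizer, ∀ j, T.col j = c →
      Equiv.swap (a τ) j * τ ∈ T.colStabilizer ∧ a (Equiv.swap (a τ) j * τ) = j := by
    intro τ hτ j hj
    have h1 : Equiv.swap (a τ) j * τ ∈ T.colStabilizer :=
      mul_mem (swap_mem_colStabilizer ((hac τ hτ).trans hj.symm)) hτ
    refine ⟨h1, (huniq _ h1 j hj ?_).symm⟩
    rw [mul_smul, Tableau.row_swap_right,
      Tableau.row_swap_of_ne _ (hak (hac τ hτ)).symm (hak hj).symm, har τ hτ]
  -- Exchanging `j` with `a τ` inside column `c` swaps their roles: it changes the sign of `τ` and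
  -- keeps the tabloid.
  refine Finset.sum_involution (fun p _ => ⟨Equiv.swap (a p.1) p.2 * p.1, a p.1⟩) ?_ ?_ ?_ ?_
  · rintro ⟨τ, j⟩ hp
    obtain ⟨hτ, hj, hjc⟩ := (hmem _).mp hp
    dsimp only at hτ hj hjc ⊢
    have h2 : tabloid (Equiv.swap (a τ) k • (Equiv.swap (a τ) j * τ) • T) =
        tabloid (Equiv.swap j k • τ • T) := by
      have h3 : Equiv.swap (a τ) k * Equiv.swap (a τ) j =
          Equiv.swap j k * Equiv.swap (a τ) k := by
        rw [Equiv.mul_swap_eq_swap_mul, Equiv.swap_apply_left,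
          Equiv.swap_apply_of_ne_of_ne hj (hak hjc), Equiv.swap_comm]
      rw [mul_smul, smul_smul, h3, mul_smul, ← smul_tabloid (Equiv.swap j k),
        tabloid_swap_of_row_eq (har τ hτ), smul_tabloid]
    rw [h2, ← add_smul, Equiv.Perm.sign_mul, Equiv.Perm.sign_swap hj.symm]
    simp
  · rintro ⟨τ, j⟩ hp _ h
    obtain ⟨hτ, hj, hjc⟩ := (hmem _).mp hp
    rw [Sigma.mk.injEq] at h
    exact hj (eq_of_heq h.2).symm
  · rintro ⟨τ, j⟩ hp
    obtain ⟨hτ, hj, hjc⟩ := (hmem _).mp hp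
    refine (hmem _).mpr ⟨(hswap τ hτ j hjc).1, ?_, hac τ hτ⟩
    dsimp only at hτ hj hjc ⊢
    rw [(hswap τ hτ j hjc).2]
    exact hj.symm
  · rintro ⟨τ, j⟩ hp
    obtain ⟨hτ, hj, hjc⟩ := (hmem _).mp hp
    dsimp only at hτ hj hjc ⊢
    rw [(hswap τ hτ j hjc).2, ← mul_assoc, Equiv.swap_comm, Equiv.swap_mul_self, one_mul]

theorem sum_spechtVector_swap (T : Tableau n μ) {k : Fin n} {c : ℕ} (hc : c < T.col k) :
    ∑ j : Fin n with T.col j = c, spechtVector (Equiv.swap j k • T) = spechtVector T := by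
  refine Subtype.ext ?_
  rw [AddSubmonoidClass.coe_finsetSum]
  exact sum_polytabloid_swap T hc

/-- The Jucys–Murphy element of `k`, acting on the Specht module. -/
noncomputable def jucysMurphy (k : Fin n) : Specht n μ →ₗ[ℝ] Specht n μ :=
  ∑ j : Fin n with j < k, spechtRep n μ (Equiv.swap j k)

theorem jucysMurphy_apply (k : Fin n) (x : Specht n μ) :
    jucysMurphy k x = ∑ j : Fin n with j < k, spechtRep n μ (Equiv.swap j k) x := by
  simp [jucysMurphy]

theorem spechtRep_swap_swap (a b : Fin n) (x : Specht n μ) :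
    spechtRep n μ (Equiv.swap a b) (spechtRep n μ (Equiv.swap a b) x) = x := by
  rw [← Module.End.mul_apply, ← map_mul, Equiv.swap_mul_self, map_one, Module.End.one_apply]

theorem spechtRep_swap_comm (σ : Equiv.Perm (Fin n)) (j k : Fin n) (x : Specht n μ) :
    spechtRep n μ σ (spechtRep n μ (Equiv.swap j k) x) =
      spechtRep n μ (Equiv.swap (σ j) (σ k)) (spechtRep n μ σ x) := by
  rw [← Module.End.mul_apply, ← map_mul, Equiv.mul_swap_eq_swap_mul, map_mul,
    Module.End.mul_apply]

theorem jucysMurphy_spechtRep_of_ne {a b k : Fin n} (hab : (a : ℕ) + 1 = b) (ha : k ≠ a)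
    (hb : k ≠ b) (x : Specht n μ) :
    jucysMurphy k (spechtRep n μ (Equiv.swap a b) x) =
      spechtRep n μ (Equiv.swap a b) (jucysMurphy k x) := by
  rw [jucysMurphy_apply, jucysMurphy_apply, map_sum]
  have hlt : ∀ j : Fin n, j < k → Equiv.swap a b j < k := by
    intro j hj
    rw [Equiv.swap_apply_def]
    split_ifs <;> omega
  refine Finset.sum_bij' (fun j _ => Equiv.swap a b j) (fun j _ => Equiv.swap a b j) ?_ ?_ ?_ ?_ ?_
  · intro j hj
    simpa using hlt j (by simpa using hj)
  · intro j hj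
    simpa using hlt j (by simpa using hj)
  · intro j _; simp
  · intro j _; simp
  · intro j _
    rw [spechtRep_swap_comm (Equiv.swap a b), Equiv.swap_apply_self,
      Equiv.swap_apply_of_ne_of_ne ha hb]

/-- The degenerate Hecke relation: conjugation by the simple reflection turns the transposition of
`j`, `a` into that of `j`, `b` for `j < a`. The additional summand for `b` is the reflection itself,
whose square gives `x`. -/
theorem jucysMurphy_spechtRep_right {a b : Fin n} (hab : (a : ℕ) + 1 = b) (x : Specht n μ) :
    jucysMurphy b (spechtRep n μ (Equiv.swap a b) x) =
      spechtRep n μ (Equiv.swap a b) (jucysMurphy a x) + x := by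
  have h : (Finset.univ.filter fun j : Fin n => j < b) =
      insert a (Finset.univ.filter fun j : Fin n => j < a) := by
    ext j
    simp only [Finset.mem_filter, Finset.mem_univ, true_and, Finset.mem_insert]
    omega
  rw [jucysMurphy_apply, h, Finset.sum_insert (by simp), spechtRep_swap_swap, add_comm,
    jucysMurphy_apply, map_sum]
  congr 1
  refine Finset.sum_congr rfl fun j hj => ?_
  have hj : j < a := by simpa using hj
  rw [spechtRep_swap_comm (Equiv.swap a b), Equiv.swap_apply_left,
    Equiv.swap_apply_of_ne_of_ne hj.ne (by omega)]

theorem jucysMurphy_spechtRep_left {a b : Fin n} (hab : (a : ℕ) + 1 = b) (x : Specht n μ) :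
    jucysMurphy a (spechtRep n μ (Equiv.swap a b) x) + x =
      spechtRep n μ (Equiv.swap a b) (jucysMurphy b x) := by
  have h := jucysMurphy_spechtRep_right hab (spechtRep n μ (Equiv.swap a b) x)
  rw [spechtRep_swap_swap] at h
  rw [h, map_add, spechtRep_swap_swap, spechtRep_swap_swap]

/-- The content of the cell of `T` containing `k`. -/
def Tableau.content (T : Tableau n μ) (k : Fin n) : ℤ := (T.col k : ℤ) - T.row k

/-- `x` is a joint eigenvector of the Jucys–Murphy elements with the contents of `T` as
eigenvalues. -/
def HasWeight (T : Tableau n μ) (x : Specht n μ) : Prop :=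
  ∀ k, jucysMurphy k x = (T.content k : ℝ) • x

/-- `T` is the standard tableau filled column by column. -/
def Tableau.ColumnFilled (T : Tableau n μ) : Prop :=
  ∀ a b : Fin n, (a : ℕ) + 1 = b → T.col a ≤ T.col b

theorem Tableau.ColumnFilled.col_le {T : Tableau n μ} (h : T.ColumnFilled) {j k : Fin n}
    (hjk : j ≤ k) : T.col j ≤ T.col k := by
  obtain ⟨d, hd⟩ := Nat.exists_eq_add_of_le (show (j : ℕ) ≤ k from hjk)
  induction d generalizing k with
  | zero => rw [show k = j from Fin.ext hd]
  | succ d ih =>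
    have hlt : (j : ℕ) + d < n := by omega
    exact (ih (k := ⟨j + d, hlt⟩) (Nat.le_add_right _ _) rfl).trans
      (h ⟨j + d, hlt⟩ k (by simp [hd]; omega))

/-- The entries below `k` in value are those in columns further left and those above `k` in its own
column. Each column on the left contributes the vector once (`sum_spechtVector_swap`), each entry
above contributes its negative, and the total is the content. -/
theorem hasWeight_spechtVector_of_columnFilled {T : Std n μ} (h : T.1.ColumnFilled) :
    HasWeight T.1 (spechtVector T.1) := by
  intro k
  rw [jucysMurphy_apply]
  simp_rw [spechtRep_spechtVector]
  have hsplit : (Finset.univ.filter fun j : Fin n => j < k) =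
      (Finset.univ.filter fun j => T.1.col j < T.1.col k) ∪
        (Finset.univ.filter fun j => T.1.col j = T.1.col k ∧ T.1.row j < T.1.row k) := by
    ext j
    simp only [Finset.mem_filter, Finset.mem_univ, true_and, Finset.mem_union]
    constructor
    · intro hj
      rcases (h.col_le hj.le).lt_or_eq with hc | hc
      · exact Or.inl hc
      · refine Or.inr ⟨hc, ?_⟩
        by_contra hr
        exact absurd (T.2.le (not_lt.mp hr) hc.ge) (not_le.mpr hj)
    · rintro (hj | ⟨hc, hr⟩)
      · by_contra hjk
        have := h.col_le (not_lt.mp hjk)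
        omega
      · refine lt_of_le_of_ne (T.2.le hr.le hc.le) ?_
        rintro rfl
        exact hr.false
  have hcard : (Finset.univ.filter fun j => T.1.col j = T.1.col k ∧ T.1.row j < T.1.row k).card =
      T.1.row k := by
    rw [← Finset.card_range (T.1.row k)]
    refine Finset.card_nbij T.1.row (fun j hj => ?_) (fun i hi j hj hij => ?_) (fun r hr => ?_)
    · simpa using (Finset.mem_filter.mp hj).2.2
    · simp only [Finset.coe_filter, Finset.mem_univ, true_and, Set.mem_ofPred_eq] at hi hj
      exact T.1.eq_of_row_eq_of_col_eq hij (hi.1.trans hj.1.symm)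
    · rw [Finset.coe_range, Set.mem_Iio] at hr
      obtain ⟨j, hjr, hjc⟩ := T.1.exists_entry_of_le (r := r) hr.le (le_refl (T.1.col k))
      exact ⟨j, by simp [hjr, hjc, hr], hjr⟩
  rw [hsplit, Finset.sum_union]
  · have h1 : ∑ j : Fin n with T.1.col j < T.1.col k, spechtVector (Equiv.swap j k • T.1) =
        (T.1.col k : ℝ) • spechtVector T.1 := by
      rw [← Finset.sum_fiberwise_of_maps_to (g := T.1.col) (t := Finset.range (T.1.col k))
        (by intro j hj; simpa using hj)]
      rw [Nat.cast_smul_eq_nsmul ℝ, ← Finset.card_range (T.1.col k), ← Finset.sum_const,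
        Finset.card_range]
      refine Finset.sum_congr rfl fun c hc => ?_
      rw [Finset.mem_range] at hc
      rw [Finset.filter_filter, ← sum_spechtVector_swap T.1 hc]
      refine Finset.sum_congr (Finset.filter_congr fun j _ => ?_) fun _ _ => rfl
      constructor
      · exact And.right
      · exact fun hj => ⟨hj ▸ hc, hj⟩
    have h2 : ∑ j : Fin n with T.1.col j = T.1.col k ∧ T.1.row j < T.1.row k,
        spechtVector (Equiv.swap j k • T.1) =
          (T.1.row k : ℝ) • -spechtVector T.1 := by
      conv_rhs => rw [← hcard]
      rw [Nat.cast_smul_eq_nsmul ℝ, ← Finset.sum_const]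
      refine Finset.sum_congr rfl fun j hj => ?_
      have hj := (Finset.mem_filter.mp hj).2
      exact spechtVector_swap_of_col_eq (by rintro rfl; exact hj.2.false) hj.1
    rw [h1, h2, Tableau.content]
    push_cast
    module
  · rw [Finset.disjoint_filter]
    rintro j _ h3 ⟨h4, _⟩
    omega

/-! ### Contents separate standard tableaux. -/

namespace Tableau

theorem content_swap (T : Tableau n μ) (a b k : Fin n) :
    (Equiv.swap a b • T).content k = T.content (Equiv.swap a b k) := by
  rw [content, content, col_smul, row_smul, Equiv.swap_inv]

variable {S T : Tableau n μ}

/-- Different cells that extend a given standard tableau have contents differing by at least two. -/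
theorem IsStandard.eq_or_two_le_abs_content_sub (hS : S.IsStandard) (hT : T.IsStandard)
    {k : Fin n} (h : ∀ j < k, S.row j = T.row j ∧ S.col j = T.col j) :
    (S.row k = T.row k ∧ S.col k = T.col k) ∨ 2 ≤ |S.content k - T.content k| := by
  -- Two different cells that can be added to the same diagram are incomparable: a smaller entry of
  -- `T` in the cell of `k` in `S` would occupy that cell in `S` too. Incomparable cells differ in
  -- both coordinates, with opposite signs.
  have key : ∀ S T : Tableau n μ, T.IsStandard →
      (∀ j < k, S.row j = T.row j ∧ S.col j = T.col j) → S.row k ≤ T.row k → S.col k ≤ T.col k →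
      S.row k = T.row k ∧ S.col k = T.col k := by
    intro S T hT h hr hc
    obtain ⟨m, hmr, hmc⟩ := T.exists_entry_of_le hr hc
    rcases (hT.le (hmr.trans_le hr) (hmc.trans_le hc)).lt_or_eq with hlt | rfl
    · have := h m hlt
      exact absurd (S.eq_of_row_eq_of_col_eq (this.1.trans hmr) (this.2.trans hmc)) hlt.ne
    · exact ⟨hmr.symm, hmc.symm⟩
  rcases le_total (S.row k) (T.row k) with hr | hr <;>
    rcases le_total (S.col k) (T.col k) with hc | hc
  · exact Or.inl (key S T hT h hr hc)
  · by_cases he : S.row k = T.row k ∧ S.col k = T.col k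
    · exact Or.inl he
    · by_cases hr' : S.row k = T.row k
      · have := key T S hS (fun j hj => ⟨(h j hj).1.symm, (h j hj).2.symm⟩) hr'.ge hc
        exact Or.inl ⟨this.1.symm, this.2.symm⟩
      · by_cases hc' : S.col k = T.col k
        · exact Or.inl (key S T hT h hr hc'.le)
        · right
          rw [le_abs, content, content]
          omega
  · by_cases he : S.row k = T.row k ∧ S.col k = T.col k
    · exact Or.inl he
    · by_cases hr' : S.row k = T.row k
      · exact Or.inl (key S T hT h hr'.le hc)
      · by_cases hc' : S.col k = T.col k
        · have := key T S hS (fun j hj => ⟨(h j hj).1.symm, (h j hj).2.symm⟩) hr hc'.ge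
          exact Or.inl ⟨this.1.symm, this.2.symm⟩
        · right
          rw [le_abs, content, content]
          omega
  · have := key T S hS (fun j hj => ⟨(h j hj).1.symm, (h j hj).2.symm⟩) hr hc
    exact Or.inl ⟨this.1.symm, this.2.symm⟩

theorem IsStandard.pos_eq_of_content_eq (hS : S.IsStandard) (hT : T.IsStandard)
    {k : Fin n} (h : ∀ j ≤ k, S.content j = T.content j) :
    S.row k = T.row k ∧ S.col k = T.col k := by
  induction k using WellFoundedLT.induction with
  | ind k ih =>
    refine (hS.eq_or_two_le_abs_content_sub hT fun j hj =>
      ih j hj fun i hi => h i (hi.trans hj.le)).resolve_right ?_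
    rw [h k le_rfl, sub_self, abs_zero]
    norm_num

theorem IsStandard.exists_content_ne (hS : S.IsStandard) (hT : T.IsStandard) (hne : S ≠ T) :
    ∃ k, S.content k ≠ T.content k := by
  by_contra! h
  exact hne (ext_row_col (fun k => (hS.pos_eq_of_content_eq hT fun j _ => h j).1)
    fun k => (hS.pos_eq_of_content_eq hT fun j _ => h j).2)

/-- Adjacent cells have contents differing by one, whereas alternative cells for `a` differ by at
least two. So the exchanged content vector belongs to no standard tableau, and a vector of that
weight must vanish. -/
theorem IsStandard.exists_content_ne_swap (hS : S.IsStandard) (hT : T.IsStandard) {a b : Fin n}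
    (hab : (a : ℕ) + 1 = b) (h : T.row a = T.row b ∨ T.col a = T.col b) :
    ∃ k, (Equiv.swap a b • T).content k ≠ S.content k := by
  by_contra! hall
  simp only [content_swap] at hall
  have hj : ∀ j < a, S.content j = T.content j := by
    intro j hj
    rw [← hall j, Equiv.swap_apply_of_ne_of_ne hj.ne (by omega)]
  have ha := hall a
  rw [Equiv.swap_apply_left] at ha
  have hone : T.content b = T.content a + 1 ∨ T.content b = T.content a - 1 := by
    rcases h with h | h
    · have := hT.col_succ_of_row_eq hab h
      left
      rw [content, content]
      omega
    · have := hT.row_succ_of_col_eq hab h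
      right
      rw [content, content]
      omega
  rcases hS.eq_or_two_le_abs_content_sub hT (k := a) fun j hj' =>
      hS.pos_eq_of_content_eq hT fun i hi => hj i (hi.trans_lt hj') with h' | h'
  · have : S.content a = T.content a := by rw [content, content, h'.1, h'.2]
    omega
  · rw [le_abs] at h'
    omega

theorem IsStandard.content_ne (hT : T.IsStandard) {a b : Fin n} (hab : (a : ℕ) + 1 = b) :
    T.content b - T.content a ≠ 0 := by
  rw [content, content]
  by_cases hr : T.row a = T.row b
  · have := hT.col_succ_of_row_eq hab hr
    omega
  · by_cases hc : T.col a = T.col b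
    · omega
    · have := hT.antidiagonal hab hr hc
      omega

theorem IsStandard.content_sub_of_row_lt (hT : T.IsStandard) {a b : Fin n}
    (hab : (a : ℕ) + 1 = b) (hs : (Equiv.swap a b • T).IsStandard) (hr : T.row b < T.row a) :
    2 ≤ T.content b - T.content a := by
  obtain ⟨h1, h2⟩ := hT.row_ne_and_col_ne_of_swap hab hs
  have := hT.antidiagonal hab h1 h2
  rw [content, content]
  omega

end Tableau

/-! ### Construction of the seminormal vectors. -/

theorem Std.lt_of_eq_swap {T T' : Std n μ} {a b : Fin n} (hab : (a : ℕ) + 1 = b)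
    (hT' : T'.1 = Equiv.swap a b • T.1) (hr : T.1.row b < T.1.row a) : T < T' := by
  refine ⟨b, ?_, fun l hl => ?_⟩
  · rwa [hT', Tableau.row_swap_right]
  · rw [hT', Tableau.row_swap_of_ne _ (by omega) hl.ne']

/-- A column filled standard tableau is the smallest one. -/
theorem Std.not_lt_of_columnFilled {S T : Std n μ} (hT : T.1.ColumnFilled) : ¬ S < T := by
  rintro ⟨k, hk, hkl⟩
  have hcol : ∀ l, k < l → S.1.col l = T.1.col l := fun l hl =>
    S.2.col_eq_of_row_eq T.2 fun l' hl' => hkl l' (hl.trans_le hl')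
  -- Column filling shows that the cell of `k` in `S` lies weakly left of its cell in `T`, besides
  -- lying higher. The entry of `S` in the latter cell then exceeds `k`, so it has the same cell in
  -- `T`, which is taken by `k`.
  obtain ⟨m, hmr, hmc⟩ := T.1.exists_entry (S.1.row_col_mem k)
  have hmk : m ≤ k := by
    by_contra h
    rw [not_le] at h
    exact h.ne (S.1.eq_of_row_eq_of_col_eq ((hkl m h).trans hmr) ((hcol m h).trans hmc)).symm
  have hc := hT.col_le hmk
  obtain ⟨p, hpr, hpc⟩ := S.1.exists_entry (T.1.row_col_mem k)
  have hkp : k ≤ p := S.2.le (by omega) (by omega)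
  have hne : k ≠ p := by rintro rfl; omega
  have hlt := lt_of_le_of_ne hkp hne
  exact hne (T.1.eq_of_row_eq_of_col_eq ((hkl p hlt).symm.trans hpr)
    ((hcol p hlt).symm.trans hpc)).symm

theorem exists_eq_add (x y : Specht n μ) : ∃ z, x = y + z := ⟨x + (-1 : ℝ) • y, by module⟩

/-- The coefficient is the one for which the extra summand `x` in the degenerate Hecke relations
cancels against the `x`-component, leaving an eigenvector with the eigenvalues of `a` and `b`
exchanged. -/
theorem hasWeight_swap {T : Tableau n μ} {a b : Fin n} (hab : (a : ℕ) + 1 = b)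
    (hne : T.content b - T.content a ≠ 0) {x y : Specht n μ} (hx : HasWeight T x)
    (hy : spechtRep n μ (Equiv.swap a b) x =
      ((T.content b - T.content a : ℤ) : ℝ)⁻¹ • x + y) :
    HasWeight (Equiv.swap a b • T) y := by
  have hδ : (((T.content b - T.content a : ℤ) : ℝ))⁻¹ * ((T.content b : ℝ) - T.content a) = 1 := by
    rw [Int.cast_sub]
    exact inv_mul_cancel₀ (by exact_mod_cast hne)
  set δ := (((T.content b - T.content a : ℤ) : ℝ))⁻¹ with hδdef
  intro k
  rw [Tableau.content_swap]
  refine add_left_cancel (a := (δ * T.content k) • x) ?_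
  have hL : jucysMurphy k (spechtRep n μ (Equiv.swap a b) x) =
      (δ * T.content k) • x + jucysMurphy k y := by
    rw [hy, map_add, map_smul, hx k, smul_smul]
  by_cases ha : k = a
  · subst ha
    have h := jucysMurphy_spechtRep_left hab x
    rw [hL, hx b, map_smul, hy] at h
    rw [Equiv.swap_apply_left]
    refine add_right_cancel (b := x) ?_
    rw [h]
    have : δ * T.content b = δ * T.content k + 1 := by linarith
    calc (T.content b : ℝ) • (δ • x + y) = (δ * T.content b) • x + (T.content b : ℝ) • y := by
          module
      _ = _ := by rw [this]; module
  · by_cases hb : k = b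
    · subst hb
      have h := jucysMurphy_spechtRep_right hab x
      rw [hL, hx a, map_smul, hy] at h
      rw [Equiv.swap_apply_right, h]
      have : δ * T.content k = δ * T.content a + 1 := by linarith
      rw [this]
      module
    · have h := jucysMurphy_spechtRep_of_ne hab ha hb x
      rw [hL, hx k, map_smul, hy] at h
      rw [Equiv.swap_apply_of_ne_of_ne ha hb, h]
      module

/-- Otherwise an involution would have the eigenvalue `d⁻¹`, which lies strictly between zero and
one. -/
theorem ne_zero_of_spechtRep_swap {a b : Fin n} {x y : Specht n μ} (hx : x ≠ 0) {d : ℤ}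
    (hd : 2 ≤ d) (hy : spechtRep n μ (Equiv.swap a b) x = (d : ℝ)⁻¹ • x + y) : y ≠ 0 := by
  rintro rfl
  rw [add_zero] at hy
  have h := spechtRep_swap_swap a b x
  rw [hy, map_smul, hy, smul_smul] at h
  have hd' : (2 : ℝ) ≤ d := by exact_mod_cast hd
  have h1 : ((d : ℝ)⁻¹ * (d : ℝ)⁻¹) = 1 := by
    by_contra hne
    have h0 : ((d : ℝ)⁻¹ * (d : ℝ)⁻¹ - 1) • x = 0 := by
      calc _ = ((d : ℝ)⁻¹ * (d : ℝ)⁻¹) • x + (-1 : ℝ) • x := by module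
        _ = 0 := by rw [h]; module
    exact hx ((smul_eq_zero.mp h0).resolve_left (sub_ne_zero.mpr hne))
  have h2 : (d : ℝ)⁻¹ ≤ 2⁻¹ := inv_anti₀ (by norm_num) hd'
  have h3 : 0 ≤ (d : ℝ)⁻¹ := by positivity
  nlinarith

section InnerProduct

variable {B : LinearMap.BilinForm ℝ (Specht n μ)}

theorem IsInvariantInnerProduct.jucysMurphy_left (hB : IsInvariantInnerProduct B) (k : Fin n)
    (x y : Specht n μ) : B (jucysMurphy k x) y = B x (jucysMurphy k y) := by
  rw [jucysMurphy_apply, jucysMurphy_apply, map_sum, map_sum, LinearMap.sum_apply]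
  refine Finset.sum_congr rfl fun j _ => ?_
  rw [← hB.invariant (Equiv.swap j k), spechtRep_swap_swap]

theorem IsInvariantInnerProduct.eq_zero_of_hasWeight (hB : IsInvariantInnerProduct B)
    {S T : Std n μ} (hne : S ≠ T) {x y : Specht n μ} (hx : HasWeight S.1 x)
    (hy : HasWeight T.1 y) : B x y = 0 := by
  obtain ⟨k, hk⟩ := S.2.exists_content_ne T.2 fun h => hne (Subtype.ext h)
  have h := hB.jucysMurphy_left k x y
  rw [hx k, hy k, map_smul, map_smul, LinearMap.smul_apply, smul_eq_mul, smul_eq_mul] at h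
  have hk' : (S.1.content k : ℝ) - T.1.content k ≠ 0 := by
    rw [sub_ne_zero]
    exact_mod_cast hk
  refine (mul_eq_zero.mp (?_ : ((S.1.content k : ℝ) - T.1.content k) * B x y = 0)).resolve_left hk'
  rw [sub_mul, h, sub_self]

end InnerProduct

/-- The vectors obtained from the polytabloid of the column filled tableau by applying Young's
formula for ascending simple reflections. -/
inductive IsSeminormalVector : Std n μ → Specht n μ → Prop
  | base {T : Std n μ} (hT : T.1.ColumnFilled) : IsSeminormalVector T (spechtVector T.1)
  | step {T U : Std n μ} {a b : Fin n} {x y : Specht n μ} (hab : (a : ℕ) + 1 = b)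
      (hU : U.1 = Equiv.swap a b • T.1) (hr : T.1.row b < T.1.row a)
      (hx : IsSeminormalVector T x)
      (hy : spechtRep n μ (Equiv.swap a b) x =
        ((T.1.content b - T.1.content a : ℤ) : ℝ)⁻¹ • x + y) : IsSeminormalVector U y

/-- A standard tableau that is not column filled arises from a smaller one by an ascending simple
reflection. -/
theorem Std.exists_descent {T : Std n μ} (hT : ¬ T.1.ColumnFilled) :
    ∃ (U : Std n μ) (a b : Fin n), (a : ℕ) + 1 = b ∧ T.1 = Equiv.swap a b • U.1 ∧
      U.1.row b < U.1.row a ∧ U < T := by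
  simp only [Tableau.ColumnFilled, not_forall, not_le] at hT
  obtain ⟨a, b, hab, hc⟩ := hT
  have hr : T.1.row a ≠ T.1.row b := by
    intro hr
    have := T.2.col_succ_of_row_eq hab hr
    omega
  have h := T.2.antidiagonal hab hr hc.ne'
  have hU : T.1 = Equiv.swap a b • Equiv.swap a b • T.1 := (T.1.swap_smul_swap_smul a b).symm
  have hr' : (Equiv.swap a b • T.1).row b < (Equiv.swap a b • T.1).row a := by
    rw [Tableau.row_swap_left, Tableau.row_swap_right]
    omega
  exact ⟨⟨Equiv.swap a b • T.1, T.2.swap_smul hab hr hc.ne'⟩, a, b, hab, hU, hr',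
    Std.lt_of_eq_swap hab hU hr'⟩

theorem exists_isSeminormalVector (T : Std n μ) : ∃ x, IsSeminormalVector T x := by
  induction T using Std.wellFounded_lt.induction with
  | _ T ih =>
    by_cases hT : T.1.ColumnFilled
    · exact ⟨_, .base hT⟩
    · obtain ⟨U, a, b, hab, hTU, hr, hlt⟩ := Std.exists_descent hT
      obtain ⟨x, hx⟩ := ih U hlt
      obtain ⟨y, hy⟩ := exists_eq_add (spechtRep n μ (Equiv.swap a b) x)
        (((U.1.content b - U.1.content a : ℤ) : ℝ)⁻¹ • x)
      exact ⟨y, .step hab hTU hr hx hy⟩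

namespace IsSeminormalVector

theorem hasWeight_and_ne_zero {T : Std n μ} {x : Specht n μ} (h : IsSeminormalVector T x) :
    HasWeight T.1 x ∧ x ≠ 0 := by
  induction h with
  | @base T hT =>
    refine ⟨hasWeight_spechtVector_of_columnFilled hT, ?_⟩
    rw [← polytabloidBasis_apply]
    exact (polytabloidBasis n μ).ne_zero T
  | @step T T' a b x y hab hT' hr hx hy ih =>
    refine ⟨?_, ?_⟩
    · rw [hT']
      exact hasWeight_swap hab (T.2.content_ne hab) ih.1 hy
    · exact ne_zero_of_spechtRep_swap ih.2 (T.2.content_sub_of_row_lt hab (hT' ▸ T'.2) hr) hy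

end IsSeminormalVector

/-- A choice of seminormal vectors. -/
noncomputable def seminormalVector (T : Std n μ) : Specht n μ :=
  (exists_isSeminormalVector T).choose

theorem isSeminormalVector_seminormalVector (T : Std n μ) :
    IsSeminormalVector T (seminormalVector T) :=
  (exists_isSeminormalVector T).choose_spec

theorem exists_basis_of_orthogonal {ι V : Type*} [Fintype ι] [AddCommMonoid V] [Module ℝ V]
    (b : Basis ι ℝ V) (B : LinearMap.BilinForm ℝ V) {v : ι → V}
    (hv : ∀ i j, i ≠ j → B (v i) (v j) = 0) (hv' : ∀ i, B (v i) (v i) ≠ 0) :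
    ∃ f : Basis ι ℝ V, ∀ i, f i = v i := by
  let _ := Module.addCommMonoidToAddCommGroup ℝ (M := V)
  have hli : LinearIndependent ℝ v :=
    LinearMap.BilinForm.linearIndependent_of_iIsOrtho (B := B) (fun i j => hv i j) hv'
  have := b.finiteDimensional_of_finite
  exact ⟨Basis.mk hli (hli.span_eq_top_of_card_eq_finrank' (finrank_eq_card_basis b).symm).ge,
    fun i => Basis.mk_apply _ _ i⟩

/-- Different weights make the vectors orthogonal for the tabloid form, hence independent, and the
polytabloid basis shows that their number is the dimension. -/
theorem exists_seminormalBasis :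
    ∃ f : Basis (Std n μ) ℝ (Specht n μ), ∀ T, f T = seminormalVector T :=
  have hB := tabloidForm_isInvariantInnerProduct (n := n) (μ := μ)
  have hw := fun T : Std n μ => (isSeminormalVector_seminormalVector T).hasWeight_and_ne_zero
  exists_basis_of_orthogonal (polytabloidBasis n μ) (tabloidForm n μ)
    (fun S T hne => hB.eq_zero_of_hasWeight hne (hw S).1 (hw T).1)
    fun T => (hB.posDef _ (hw T).2).ne'

/-- The seminormal basis of the Specht module. -/
noncomputable def seminormalBasis (n : ℕ) (μ : YoungDiagram) :
    Basis (Std n μ) ℝ (Specht n μ) :=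
  exists_seminormalBasis.choose

theorem seminormalBasis_apply (T : Std n μ) : seminormalBasis n μ T = seminormalVector T :=
  exists_seminormalBasis.choose_spec T

theorem isSeminormalVector_seminormalBasis (T : Std n μ) :
    IsSeminormalVector T (seminormalBasis n μ T) := by
  rw [seminormalBasis_apply]
  exact isSeminormalVector_seminormalVector T

/-! ### Joint eigenspaces and triangularity. -/

theorem hasWeight_seminormalBasis (T : Std n μ) : HasWeight T.1 (seminormalBasis n μ T) :=
  (isSeminormalVector_seminormalBasis T).hasWeight_and_ne_zero.1

theorem HasWeight.repr_eq_zero {S : Tableau n μ} {y : Specht n μ} (hy : HasWeight S y)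
    {T : Std n μ} {k : Fin n} (hk : S.content k ≠ T.1.content k) :
    (seminormalBasis n μ).repr y T = 0 := by
  have h : (seminormalBasis n μ).coord T ∘ₗ jucysMurphy k =
      (T.1.content k : ℝ) • (seminormalBasis n μ).coord T := by
    refine (seminormalBasis n μ).ext fun R => ?_
    rw [LinearMap.comp_apply, hasWeight_seminormalBasis R k, map_smul, LinearMap.smul_apply]
    by_cases hR : R = T
    · rw [hR]
    · simp [hR]
  have h' := LinearMap.congr_fun h y
  rw [LinearMap.comp_apply, hy k, map_smul, LinearMap.smul_apply, smul_eq_mul, smul_eq_mul] at h'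
  have hk' : (S.content k : ℝ) - T.1.content k ≠ 0 := by
    rw [sub_ne_zero]
    exact_mod_cast hk
  refine (mul_eq_zero.mp (?_ : ((S.content k : ℝ) - T.1.content k) *
    (seminormalBasis n μ).coord T y = 0)).resolve_left hk'
  rw [sub_mul, h', sub_self]

theorem HasWeight.eq_smul {S : Std n μ} {y : Specht n μ} (hy : HasWeight S.1 y) :
    y = (seminormalBasis n μ).repr y S • seminormalBasis n μ S := by
  conv_lhs => rw [← (seminormalBasis n μ).sum_repr y]
  refine Finset.sum_eq_single S (fun T _ hne => ?_) fun h => absurd (Finset.mem_univ S) h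
  obtain ⟨k, hk⟩ := S.2.exists_content_ne T.2 fun h => hne (Subtype.ext h.symm)
  rw [hy.repr_eq_zero hk, zero_smul]

/-- The remainder has the content vector of a non-standard tableau as its weight, so all its
coordinates vanish. -/
theorem spechtRep_seminormalBasis_of_eq {T : Std n μ} {a b : Fin n} (hab : (a : ℕ) + 1 = b)
    (h : T.1.row a = T.1.row b ∨ T.1.col a = T.1.col b) :
    spechtRep n μ (Equiv.swap a b) (seminormalBasis n μ T) =
      ((T.1.content b - T.1.content a : ℤ) : ℝ)⁻¹ • seminormalBasis n μ T := by
  obtain ⟨y, hy⟩ := exists_eq_add (spechtRep n μ (Equiv.swap a b) (seminormalBasis n μ T))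
    (((T.1.content b - T.1.content a : ℤ) : ℝ)⁻¹ • seminormalBasis n μ T)
  have hw := hasWeight_swap hab (T.2.content_ne hab) (hasWeight_seminormalBasis T) hy
  have h0 : y = 0 := by
    refine (seminormalBasis n μ).ext_elem fun S => ?_
    obtain ⟨k, hk⟩ := S.2.exists_content_ne_swap T.2 hab h
    rw [hw.repr_eq_zero hk, map_zero, Finsupp.zero_apply]
  rw [hy, h0, add_zero]

theorem exists_spechtRep_seminormalBasis {T T' : Std n μ} {a b : Fin n} (hab : (a : ℕ) + 1 = b)
    (hT' : T'.1 = Equiv.swap a b • T.1) :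
    ∃ c d : ℝ, spechtRep n μ (Equiv.swap a b) (seminormalBasis n μ T) =
      c • seminormalBasis n μ T + d • seminormalBasis n μ T' := by
  obtain ⟨y, hy⟩ := exists_eq_add (spechtRep n μ (Equiv.swap a b) (seminormalBasis n μ T))
    (((T.1.content b - T.1.content a : ℤ) : ℝ)⁻¹ • seminormalBasis n μ T)
  have hw := hasWeight_swap hab (T.2.content_ne hab) (hasWeight_seminormalBasis T) hy
  rw [← hT'] at hw
  exact ⟨_, _, hw.eq_smul ▸ hy⟩

/-- The span of the seminormal basis vectors strictly below `T` in the dominance order. -/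
noncomputable def lowerSpan (T : Std n μ) : Submodule ℝ (Specht n μ) :=
  Submodule.span ℝ (seminormalBasis n μ '' {S | S.1.Dominated T.1 ∧ S ≠ T})

theorem mem_lowerSpan {S T : Std n μ} (h : S.1.Dominated T.1) (hne : S ≠ T) :
    seminormalBasis n μ S ∈ lowerSpan T :=
  Submodule.subset_span ⟨S, ⟨h, hne⟩, rfl⟩

theorem repr_eq_zero_of_mem_lowerSpan {T : Std n μ} {z : Specht n μ} (hz : z ∈ lowerSpan T) :
    (seminormalBasis n μ).repr z T = 0 := by
  suffices h : lowerSpan T ≤ LinearMap.ker ((seminormalBasis n μ).coord T) from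
    LinearMap.mem_ker.mp (h hz)
  refine Submodule.span_le.mpr ?_
  rintro _ ⟨S, ⟨_, hne⟩, rfl⟩
  simp [hne]

theorem spechtRep_mem_lowerSpan {T T' : Std n μ} {a b : Fin n} (hab : (a : ℕ) + 1 = b)
    (hT' : T'.1 = Equiv.swap a b • T.1) (hr : T.1.row b < T.1.row a) {z : Specht n μ}
    (hz : z ∈ lowerSpan T) : spechtRep n μ (Equiv.swap a b) z ∈ lowerSpan T' := by
  suffices h : lowerSpan T ≤ (lowerSpan T').comap (spechtRep n μ (Equiv.swap a b)) from h hz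
  refine Submodule.span_le.mpr ?_
  rintro _ ⟨S, ⟨hS, hne⟩, rfl⟩
  rw [SetLike.mem_coe, Submodule.mem_comap]
  have hTT' := Std.lt_of_eq_swap hab hT' hr
  have hST' : seminormalBasis n μ S ∈ lowerSpan T' := by
    refine mem_lowerSpan (hS.trans (hT' ▸ Tableau.dominated_swap_smul hab hr.le)) ?_
    rintro rfl
    exact Std.lt_irrefl S (Std.lt_trans (Std.lt_of_dominated hS hne) hTT')
  by_cases h : S.1.row a = S.1.row b ∨ S.1.col a = S.1.col b
  · rw [spechtRep_seminormalBasis_of_eq hab h]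
    exact Submodule.smul_mem _ _ hST'
  · push Not at h
    have hS' := S.2.swap_smul hab h.1 h.2
    obtain ⟨c, d, hcd⟩ := exists_spechtRep_seminormalBasis (T := S)
      (T' := ⟨Equiv.swap a b • S.1, hS'⟩) hab rfl
    rw [hcd]
    refine Submodule.add_mem _ (Submodule.smul_mem _ _ hST') (Submodule.smul_mem _ _ ?_)
    -- This is where dominance is needed: exchanging `a` and `b` in both tableaux preserves it when
    -- the exchange raises `T`.
    refine mem_lowerSpan (hT' ▸ hS.swap_smul_swap_smul hab hr.le) fun he => hne ?_
    have he' := congrArg Subtype.val he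
    rw [hT'] at he'
    exact Subtype.ext (MulAction.injective _ he')

/-- Applying the reflection to `spechtVector T.1 = x + z` yields `y` plus a multiple of `x` plus the
image of `z`, and the last two are lower for the new tableau. -/
theorem IsSeminormalVector.exists_add_eq {T : Std n μ} {x : Specht n μ}
    (h : IsSeminormalVector T x) : ∃ z ∈ lowerSpan T, spechtVector T.1 = x + z := by
  induction h with
  | base hT => exact ⟨0, Submodule.zero_mem _, (add_zero _).symm⟩
  | @step T T' a b x y hab hT' hr hx hy ih =>
    obtain ⟨z, hz, hxz⟩ := ih
    refine ⟨((T.1.content b - T.1.content a : ℤ) : ℝ)⁻¹ • x +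
      spechtRep n μ (Equiv.swap a b) z, Submodule.add_mem _ (Submodule.smul_mem _ _ ?_)
        (spechtRep_mem_lowerSpan hab hT' hr hz), ?_⟩
    · rw [hx.hasWeight_and_ne_zero.1.eq_smul]
      refine Submodule.smul_mem _ _ (mem_lowerSpan ?_ ?_)
      · exact hT' ▸ Tableau.dominated_swap_smul hab hr.le
      · rintro rfl
        exact Std.lt_irrefl _ (Std.lt_of_eq_swap hab hT' hr)
    · rw [hT', ← spechtRep_spechtVector, hxz, map_add, hy, ← add_assoc, add_comm y]

/-- Path independence: joint eigenspaces of standard weights are lines, and both vectors have the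
same `T`-coordinate as the polytabloid of `T`. -/
theorem IsSeminormalVector.eq_seminormalBasis {T : Std n μ} {x : Specht n μ}
    (h : IsSeminormalVector T x) : x = seminormalBasis n μ T := by
  obtain ⟨z, hz, hxz⟩ := h.exists_add_eq
  obtain ⟨w, hw, hfw⟩ := (isSeminormalVector_seminormalBasis T).exists_add_eq
  have he := congrArg (fun v => (seminormalBasis n μ).repr v T) (hxz.symm.trans hfw)
  simp only [map_add, Finsupp.add_apply, repr_eq_zero_of_mem_lowerSpan hz,
    repr_eq_zero_of_mem_lowerSpan hw, add_zero, Basis.repr_self, Finsupp.single_eq_same] at he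
  rw [h.hasWeight_and_ne_zero.1.eq_smul, he, one_smul]

/-! ### Young's formulas and feasibility of the base change. -/

theorem spechtRep_seminormalBasis_up {T T' : Std n μ} {a b : Fin n} (hab : (a : ℕ) + 1 = b)
    (hT' : T'.1 = Equiv.swap a b • T.1) (hr : T.1.row b < T.1.row a) :
    spechtRep n μ (Equiv.swap a b) (seminormalBasis n μ T) =
      ((T.1.content b - T.1.content a : ℤ) : ℝ)⁻¹ • seminormalBasis n μ T +
        seminormalBasis n μ T' := by
  obtain ⟨y, hy⟩ := exists_eq_add (spechtRep n μ (Equiv.swap a b) (seminormalBasis n μ T))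
    (((T.1.content b - T.1.content a : ℤ) : ℝ)⁻¹ • seminormalBasis n μ T)
  rw [hy, ← (IsSeminormalVector.step hab hT' hr (isSeminormalVector_seminormalBasis T)
    hy).eq_seminormalBasis]

/-- Apply the reflection to the ascending formula at `T'` and use that it is an involution; the
axial distance changes sign. -/
theorem spechtRep_seminormalBasis_down {T T' : Std n μ} {a b : Fin n} (hab : (a : ℕ) + 1 = b)
    (hT' : T'.1 = Equiv.swap a b • T.1) (hr : T.1.row a < T.1.row b) :
    spechtRep n μ (Equiv.swap a b) (seminormalBasis n μ T) =
      ((T.1.content b - T.1.content a : ℤ) : ℝ)⁻¹ • seminormalBasis n μ T +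
        (1 - (((T.1.content b - T.1.content a : ℤ) : ℝ)⁻¹) ^ 2) • seminormalBasis n μ T' := by
  have hT : T.1 = Equiv.swap a b • T'.1 := by rw [hT', Tableau.swap_smul_swap_smul]
  have h := spechtRep_seminormalBasis_up hab hT
    (by rwa [hT', Tableau.row_swap_left, Tableau.row_swap_right])
  have h2 := congrArg (spechtRep n μ (Equiv.swap a b)) h
  rw [spechtRep_swap_swap, map_add, map_smul, h] at h2
  have hc : (T'.1.content b - T'.1.content a : ℤ) = -(T.1.content b - T.1.content a) := by
    rw [hT', Tableau.content_swap, Tableau.content_swap, Equiv.swap_apply_left,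
      Equiv.swap_apply_right]
    ring
  rw [hc, Int.cast_neg, inv_neg] at h2
  generalize ((T.1.content b - T.1.content a : ℤ) : ℝ)⁻¹ = δ at h2 ⊢
  refine add_left_cancel
    (a := (-δ) • ((-δ) • seminormalBasis n μ T' + seminormalBasis n μ T)) ?_
  rw [← h2]
  module

theorem Std.row_lt_of_lt_swap {T T' : Std n μ} {a b : Fin n} (hab : (a : ℕ) + 1 = b)
    (hT' : T'.1 = Equiv.swap a b • T.1) (hlt : T < T') : T.1.row b < T.1.row a := by
  have hne := (T.2.row_ne_and_col_ne_of_swap hab (hT' ▸ T'.2)).1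
  refine lt_of_le_of_ne (not_lt.mp fun hr => ?_) hne.symm
  have hT : T.1 = Equiv.swap a b • T'.1 := by rw [hT', Tableau.swap_smul_swap_smul]
  refine Std.lt_irrefl T (Std.lt_trans hlt (Std.lt_of_eq_swap hab hT ?_))
  rwa [hT', Tableau.row_swap_left, Tableau.row_swap_right]

theorem Std.row_lt_of_swap_lt {T T' : Std n μ} {a b : Fin n} (hab : (a : ℕ) + 1 = b)
    (hT' : T'.1 = Equiv.swap a b • T.1) (hlt : T' < T) : T.1.row a < T.1.row b := by
  have hT : T.1 = Equiv.swap a b • T'.1 := by rw [hT', Tableau.swap_smul_swap_smul]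
  have := Std.row_lt_of_lt_swap hab hT hlt
  rwa [hT', Tableau.row_swap_left, Tableau.row_swap_right] at this

theorem isYoungSeminormal_seminormalBasis : IsYoungSeminormal (seminormalBasis n μ) where
  same_row i hi T h := by
    have hc := T.2.col_succ_of_row_eq (a := ⟨i, Nat.lt_of_succ_lt hi⟩) (b := ⟨i + 1, hi⟩) rfl h
    have hd : T.1.content ⟨i + 1, hi⟩ - T.1.content ⟨i, Nat.lt_of_succ_lt hi⟩ = 1 := by
      rw [Tableau.content, Tableau.content]
      omega
    have := spechtRep_seminormalBasis_of_eq (T := T) (a := ⟨i, Nat.lt_of_succ_lt hi⟩)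
      (b := ⟨i + 1, hi⟩) rfl (Or.inl h)
    rwa [hd, Int.cast_one, inv_one, one_smul] at this
  same_col i hi T h := by
    have hc := T.2.row_succ_of_col_eq (a := ⟨i, Nat.lt_of_succ_lt hi⟩) (b := ⟨i + 1, hi⟩) rfl h
    have hd : T.1.content ⟨i + 1, hi⟩ - T.1.content ⟨i, Nat.lt_of_succ_lt hi⟩ = -1 := by
      rw [Tableau.content, Tableau.content]
      omega
    have := spechtRep_seminormalBasis_of_eq (T := T) (a := ⟨i, Nat.lt_of_succ_lt hi⟩)
      (b := ⟨i + 1, hi⟩) rfl (Or.inr h)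
    rw [hd] at this
    refine this.trans ?_
    rw [show (((-1 : ℤ) : ℝ))⁻¹ = -1 by norm_num]
    module
  up i hi T T' hT' hlt :=
    spechtRep_seminormalBasis_up rfl hT' (Std.row_lt_of_lt_swap rfl hT' hlt)
  down i hi T T' hT' hlt :=
    spechtRep_seminormalBasis_down rfl hT' (Std.row_lt_of_swap_lt rfl hT' hlt)

/-- The unitriangular expansion of polytabloids in seminormal vectors is inverted by induction along
the last letter order. -/
theorem repr_seminormalBasis (T : Std n μ) :
    (polytabloidBasis n μ).repr (seminormalBasis n μ T) T = 1 ∧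
      ∀ S, T < S → (polytabloidBasis n μ).repr (seminormalBasis n μ T) S = 0 := by
  induction T using Std.wellFounded_lt.induction with
  | _ T ih =>
    obtain ⟨z, hz, hTz⟩ := (isSeminormalVector_seminormalBasis T).exists_add_eq
    have hz0 : ∀ S, T = S ∨ T < S → (polytabloidBasis n μ).repr z S = 0 := by
      intro S hS
      suffices h : lowerSpan T ≤ LinearMap.ker ((polytabloidBasis n μ).coord S) from
        LinearMap.mem_ker.mp (h hz)
      refine Submodule.span_le.mpr ?_
      rintro _ ⟨R, ⟨hR, hne⟩, rfl⟩
      have hlt := Std.lt_of_dominated hR hne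
      refine (ih R hlt).2 S ?_
      rcases hS with rfl | hS
      · exact hlt
      · exact Std.lt_trans hlt hS
    have hS : ∀ S, (polytabloidBasis n μ).repr (seminormalBasis n μ T) S +
        (polytabloidBasis n μ).repr z S = Finsupp.single T 1 S := by
      intro S
      rw [← Finsupp.add_apply, ← map_add, ← hTz, ← polytabloidBasis_apply, Basis.repr_self]
    constructor
    · have := hS T
      rwa [hz0 T (Or.inl rfl), add_zero, Finsupp.single_eq_same] at this
    · intro S hlt
      have hne : T ≠ S := by
        rintro rfl
        exact Std.lt_irrefl _ hlt
      have := hS S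
      rwa [hz0 S (Or.inr hlt), add_zero, Finsupp.single_eq_of_ne hne.symm] at this

theorem isUpperUnitriangular_toMatrix_seminormalBasis :
    IsUpperUnitriangular ((polytabloidBasis n μ).toMatrix (seminormalBasis n μ)) :=
  ⟨fun T => (repr_seminormalBasis T).1, fun S T h => (repr_seminormalBasis T).2 S h⟩

/-- With `δ` the inverse axial distance, the possible nonzero entries are `2`, `1 + δ`, `1` and `1 -
δ ^ 2`. For exchangeable entries `|δ| ≤ 1/2`. -/
theorem onePlusMatrix_seminormalBasis_nonneg (i : ℕ) (hi : i + 1 < n) (S T : Std n μ) :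
    0 ≤ onePlusMatrix (seminormalBasis n μ) i hi S T := by
  have hY := isYoungSeminormal_seminormalBasis (n := n) (μ := μ)
  set a : Fin n := ⟨i, Nat.lt_of_succ_lt hi⟩ with ha
  set b : Fin n := ⟨i + 1, hi⟩ with hb
  have hsingle : ∀ R : Std n μ, 0 ≤ (Finsupp.single R (1 : ℝ)) S := fun R => by
    rw [Finsupp.single_apply]
    split_ifs <;> norm_num
  have hrepr : onePlusMatrix (seminormalBasis n μ) i hi S T = Finsupp.single T (1 : ℝ) S +
      (seminormalBasis n μ).repr
        (spechtRep n μ (simpleReflection i hi) (seminormalBasis n μ T)) S := by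
    rw [onePlusMatrix, LinearMap.toMatrix_apply, LinearMap.add_apply, Module.End.one_apply,
      map_add, Finsupp.add_apply, Basis.repr_self]
  rw [hrepr]
  have hT := hsingle T
  by_cases hr : T.1.row a = T.1.row b
  · rw [hY.same_row i hi T hr, Basis.repr_self]
    exact add_nonneg hT hT
  by_cases hc : T.1.col a = T.1.col b
  · have h1 : spechtRep n μ (simpleReflection i hi) (seminormalBasis n μ T) =
        (-1 : ℝ) • seminormalBasis n μ T := by
      rw [hY.same_col i hi T hc]
      module
    rw [h1, map_smul, Basis.repr_self, Finsupp.smul_apply, smul_eq_mul]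
    linarith
  have hab : (a : ℕ) + 1 = b := rfl
  have hs := T.2.swap_smul hab hr hc
  obtain ⟨T', hT'⟩ : ∃ T' : Std n μ, T'.1 = Equiv.swap a b • T.1 := ⟨⟨_, hs⟩, rfl⟩
  rcases T.2.antidiagonal hab hr hc with h | h
  · have hd : 0 ≤ (((T.1.content b - T.1.content a : ℤ) : ℝ))⁻¹ := by
      have := T.2.content_sub_of_row_lt hab hs h.1
      have : (0 : ℝ) ≤ ((T.1.content b - T.1.content a : ℤ) : ℝ) := by
        exact_mod_cast (by omega : (0 : ℤ) ≤ T.1.content b - T.1.content a)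
      positivity
    have h1 := spechtRep_seminormalBasis_up hab hT' h.1
    rw [simpleReflection, h1, map_add, map_smul, Basis.repr_self, Basis.repr_self,
      Finsupp.add_apply, Finsupp.smul_apply, smul_eq_mul]
    have := hsingle T'
    positivity
  · have hd : 2 ≤ -(T.1.content b - T.1.content a) := by
      rw [Tableau.content, Tableau.content]
      omega
    have hd' : (2 : ℝ) ≤ -((T.1.content b - T.1.content a : ℤ) : ℝ) := by exact_mod_cast hd
    have h1 := spechtRep_seminormalBasis_down hab hT' h.1
    rw [simpleReflection, h1, map_add, map_smul, map_smul, Basis.repr_self, Basis.repr_self,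
      Finsupp.add_apply, Finsupp.smul_apply, Finsupp.smul_apply, smul_eq_mul, smul_eq_mul]
    have hinv : -2⁻¹ ≤ ((T.1.content b - T.1.content a : ℤ) : ℝ)⁻¹ ∧
        ((T.1.content b - T.1.content a : ℤ) : ℝ)⁻¹ ≤ 0 := by
      have h2 := inv_anti₀ (by norm_num : (0 : ℝ) < 2) hd'
      have h3 : 0 ≤ (-((T.1.content b - T.1.content a : ℤ) : ℝ))⁻¹ :=
        inv_nonneg.mpr (by linarith)
      rw [inv_neg] at h2 h3
      constructor <;> linarith
    generalize ((T.1.content b - T.1.content a : ℤ) : ℝ)⁻¹ = δ at hinv ⊢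
    have h2 := hsingle T'
    have h3 : 0 ≤ 1 - δ ^ 2 := by nlinarith
    have h4 := mul_nonneg h3 h2
    have h5 : 0 ≤ (1 + δ) * Finsupp.single T (1 : ℝ) S := mul_nonneg (by linarith) hT
    linarith

theorem toMatrix_seminormalBasis_mem_feasible :
    (polytabloidBasis n μ).toMatrix (seminormalBasis n μ) ∈ feasible (polytabloidBasis n μ) := by
  refine ⟨isUpperUnitriangular_toMatrix_seminormalBasis, fun i hi S T => ?_⟩
  have hinv : ((polytabloidBasis n μ).toMatrix (seminormalBasis n μ))⁻¹ =
      (seminormalBasis n μ).toMatrix (polytabloidBasis n μ) :=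
    Matrix.inv_eq_left_inv (Basis.toMatrix_mul_toMatrix_flip _ _)
  rw [hinv, onePlusMatrix, basis_toMatrix_mul_linearMap_toMatrix_mul_basis_toMatrix]
  exact onePlusMatrix_seminormalBasis_nonneg i hi S T

/-! ### Minimization by orthogonality. -/

section Minimization

variable {B : LinearMap.BilinForm ℝ (Specht n μ)}

theorem objective_eq_sum (b : Basis (Std n μ) ℝ (Specht n μ))
    (B : LinearMap.BilinForm ℝ (Specht n μ)) (A : Matrix (Std n μ) (Std n μ) ℝ) :
    objective b B A = ∑ T, B (∑ S, A S T • b S) (∑ S, A S T • b S) := by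
  unfold objective Matrix.trace
  refine Finset.sum_congr rfl fun T _ => ?_
  simp only [Matrix.diag_apply, Matrix.mul_apply, Matrix.transpose_apply, Matrix.of_apply,
    map_sum, map_smul, LinearMap.sum_apply, LinearMap.smul_apply, smul_eq_mul, Finset.sum_mul]
  refine Finset.sum_congr rfl fun R _ => ?_
  rw [Finset.mul_sum]
  refine Finset.sum_congr rfl fun S _ => ?_
  ring

/-- The Gram–Schmidt property: a polytabloid lies in the span of seminormal vectors that are not
larger, and these are orthogonal to the one of `T`. -/
theorem IsInvariantInnerProduct.seminormalBasis_polytabloidBasis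
    (hB : IsInvariantInnerProduct B) {S T : Std n μ} (hlt : S < T) :
    B (seminormalBasis n μ T) (polytabloidBasis n μ S) = 0 := by
  have horth : ∀ R, R < T → B (seminormalBasis n μ T) (seminormalBasis n μ R) = 0 := by
    intro R hR
    refine hB.eq_zero_of_hasWeight ?_ (hasWeight_seminormalBasis T) (hasWeight_seminormalBasis R)
    rintro rfl
    exact Std.lt_irrefl _ hR
  obtain ⟨z, hz, hSz⟩ := (isSeminormalVector_seminormalBasis S).exists_add_eq
  rw [polytabloidBasis_apply, hSz, map_add, horth S hlt, zero_add]
  suffices h : lowerSpan S ≤ LinearMap.ker (B (seminormalBasis n μ T)) from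
    LinearMap.mem_ker.mp (h hz)
  refine Submodule.span_le.mpr ?_
  rintro _ ⟨R, ⟨hR, hne⟩, rfl⟩
  exact horth R (Std.lt_trans (Std.lt_of_dominated hR hne) hlt)

/-- Among the upper unitriangular matrices the objective is smallest exactly at the base-change
matrix to the seminormal basis. -/
theorem IsInvariantInnerProduct.objective_seminormalBasis_lt (hB : IsInvariantInnerProduct B)
    {A : Matrix (Std n μ) (Std n μ) ℝ} (hA : IsUpperUnitriangular A)
    (hne : A ≠ (polytabloidBasis n μ).toMatrix (seminormalBasis n μ)) :
    objective (polytabloidBasis n μ) B ((polytabloidBasis n μ).toMatrix (seminormalBasis n μ)) <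
      objective (polytabloidBasis n μ) B A := by
  have hA' := isUpperUnitriangular_toMatrix_seminormalBasis (n := n) (μ := μ)
  rw [objective_eq_sum, objective_eq_sum]
  have hf : ∀ T : Std n μ, ∑ S, (polytabloidBasis n μ).toMatrix (seminormalBasis n μ) S T •
      polytabloidBasis n μ S = seminormalBasis n μ T := fun T =>
    (polytabloidBasis n μ).sum_toMatrix_smul_self _ T
  set A₀ := (polytabloidBasis n μ).toMatrix (seminormalBasis n μ) with hA₀
  have hsplit : ∀ T, ∑ S, A S T • polytabloidBasis n μ S = seminormalBasis n μ T +
      ∑ S, (A S T - A₀ S T) • polytabloidBasis n μ S := by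
    intro T
    rw [← hf T, ← Finset.sum_add_distrib]
    refine Finset.sum_congr rfl fun S _ => ?_
    module
  -- Both matrices are unitriangular, so column `T` of their difference involves only polytabloids
  -- with index below `T`. Pythagoras then splits the squared length.
  have horth : ∀ T, B (seminormalBasis n μ T)
      (∑ S, (A S T - A₀ S T) • polytabloidBasis n μ S) = 0 := by
    intro T
    rw [map_sum]
    refine Finset.sum_eq_zero fun S _ => ?_
    rw [map_smul]
    rcases Std.lt_or_eq_or_gt S T with h | rfl | h
    · rw [hB.seminormalBasis_polytabloidBasis h, smul_zero]
    · rw [hA.1, hA'.1, sub_self, zero_smul]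
    · rw [hA.2 S T h, hA'.2 S T h, sub_self, zero_smul]
  have hB' : ∀ T, B (∑ S, A S T • polytabloidBasis n μ S) (∑ S, A S T • polytabloidBasis n μ S) =
      B (seminormalBasis n μ T) (seminormalBasis n μ T) +
        B (∑ S, (A S T - A₀ S T) • polytabloidBasis n μ S)
          (∑ S, (A S T - A₀ S T) • polytabloidBasis n μ S) := by
    intro T
    have horth' := (hB.symm _ _).trans (horth T)
    rw [hsplit, map_add, map_add, LinearMap.add_apply, LinearMap.add_apply, horth, horth',
      zero_add, add_zero]
  have hnonneg : ∀ x, 0 ≤ B x x := by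
    intro x
    by_cases hx : x = 0
    · rw [hx, map_zero]
    · exact (hB.posDef x hx).le
  simp_rw [hB', hf]
  obtain ⟨T, hT⟩ : ∃ T, ∑ S, (A S T - A₀ S T) • polytabloidBasis n μ S ≠ 0 := by
    by_contra! hall
    refine hne (Matrix.ext fun S T => ?_)
    have h := congrArg (fun x => (polytabloidBasis n μ).repr x S) (hall T)
    simp only [Basis.repr_sum_self, map_zero, Finsupp.zero_apply] at h
    linarith
  refine Finset.sum_lt_sum (fun T _ => le_add_of_nonneg_right (hnonneg _))
    ⟨T, Finset.mem_univ T, lt_add_of_pos_right _ (hB.posDef _ hT)⟩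

theorem IsInvariantInnerProduct.isMinimizer_iff (hB : IsInvariantInnerProduct B)
    (A : Matrix (Std n μ) (Std n μ) ℝ) :
    IsMinimizer (polytabloidBasis n μ) B A ↔
      A = (polytabloidBasis n μ).toMatrix (seminormalBasis n μ) := by
  constructor
  · rintro ⟨hA, hmin⟩
    by_contra hne
    exact absurd (hmin toMatrix_seminormalBasis_mem_feasible)
      (not_le.mpr (hB.objective_seminormalBasis_lt hA.1 hne))
  · rintro rfl
    refine ⟨toMatrix_seminormalBasis_mem_feasible, fun A hA => ?_⟩
    by_cases h : A = (polytabloidBasis n μ).toMatrix (seminormalBasis n μ)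
    · rw [h]
      exact le_refl (objective _ _ _)
    · exact (hB.objective_seminormalBasis_lt hA.1 h).le

end Minimization

/-! ### Uniqueness of the seminormal basis and conclusion. -/

/-- Young's formulas and unitriangularity determine the seminormal basis. -/
theorem IsYoungSeminormal.eq_seminormalBasis {e : Basis (Std n μ) ℝ (Specht n μ)}
    (he : IsYoungSeminormal e) (hA : IsUpperUnitriangular ((polytabloidBasis n μ).toMatrix e)) :
    e = seminormalBasis n μ := by
  refine Basis.eq_of_apply_eq fun T => IsSeminormalVector.eq_seminormalBasis ?_
  induction T using Std.wellFounded_lt.induction with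
  | _ T ih =>
    -- Young's formulas leave the scale free. Unitriangularity fixes it at the column filled
    -- tableau, which is minimal, and the ascending formula propagates it.
    by_cases hT : T.1.ColumnFilled
    · have h : e T = spechtVector T.1 := by
        rw [← polytabloidBasis_apply]
        refine (polytabloidBasis n μ).ext_elem fun S => ?_
        rw [Basis.repr_self]
        rcases Std.lt_or_eq_or_gt S T with h | rfl | h
        · exact absurd h (Std.not_lt_of_columnFilled hT)
        · rw [Finsupp.single_eq_same]
          exact hA.1 S
        · have hne : S ≠ T := by
            rintro rfl
            exact Std.lt_irrefl _ h
          rw [Finsupp.single_eq_of_ne hne]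
          exact hA.2 S T h
      rw [h]
      exact .base hT
    · obtain ⟨U, ⟨i, hi⟩, ⟨j, hj⟩, hab, hTU, hr, hlt⟩ := Std.exists_descent hT
      obtain rfl : i + 1 = j := hab
      exact .step rfl hTU hr (ih U hlt) (he.up i hj U T hTU hlt)

end SpechtOpt

theorem mainTheorem1 (n : ℕ) (μ : YoungDiagram) (hμ : μ.card = n) :
    ∃ b : Module.Basis (SpechtOpt.Std n μ) ℝ (SpechtOpt.Specht n μ),
      (∀ T, (b T : SpechtOpt.PermModule n μ) = SpechtOpt.polytabloid T.1) ∧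
      ∀ B : LinearMap.BilinForm ℝ (SpechtOpt.Specht n μ),
        SpechtOpt.IsInvariantInnerProduct B →
          (∃! A, SpechtOpt.IsMinimizer b B A) ∧
          ∀ A : Matrix (SpechtOpt.Std n μ) (SpechtOpt.Std n μ) ℝ,
            SpechtOpt.IsMinimizer b B A ↔
              SpechtOpt.IsUpperUnitriangular A ∧
              ∃ e : Module.Basis (SpechtOpt.Std n μ) ℝ (SpechtOpt.Specht n μ),
                SpechtOpt.IsYoungSeminormal e ∧ A = b.toMatrix e := by
  refine ⟨SpechtOpt.polytabloidBasis n μ, fun T => ?_, fun B hB => ⟨?_, fun A => ?_⟩⟩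
  · rw [SpechtOpt.polytabloidBasis_apply]
    rfl
  · exact ⟨_, (hB.isMinimizer_iff _).mpr rfl, fun A hA => (hB.isMinimizer_iff A).mp hA⟩
  · rw [hB.isMinimizer_iff]
    constructor
    · rintro rfl
      exact ⟨SpechtOpt.isUpperUnitriangular_toMatrix_seminormalBasis, _,
        SpechtOpt.isYoungSeminormal_seminormalBasis, rfl⟩
    · rintro ⟨hA, e, he, rfl⟩
      rw [he.eq_seminormalBasis hA]
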